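/- **Setting.** Let $1<p\le 2$, $q=p/(p-1)$, $X=\ell^p(\mathbb N)$ (real sequences), $Y$ a real Hilbert space, $F:X\to Y$ Fréchet differentiable, $y,y^\delta\in Y$ and $\delta>0$ with $\|y-y^\delta\|\le\delta$. Put $f_p(x)=\frac1p\|x\|^p$, $J_p(x)=(|x_i|^{p-1}\operatorname{sgn}x_i)_i\in\ell^q=X^*$, $J_q(\xi)=(|\xi_i|^{q-1}\operatorname{sgn}\xi_i)_i\in X$ for $\xi\in\ell^q$, and $$D(z,x)=f_p(z)-f_p(x)-\langle J_p(x),z-x\rangle,\qquad \Phi_\alpha(x)=\tfrac12\|F(x)-y^\delta\|^2+\alpha f_p(x),$$ $$\nabla\Phi_\alpha(x)=F'(x)^*(F(x)-y^\delta)+\alpha J_p(x).$$ **Assumptions on $F$.** There are $L,c,\varrho>0$ and $s>2$ with $\varrho<\frac1{sc}$ such that, for all $x,z\in X$, $\|F'(x)-F'(z)\|\le L\|x-z\|$ and $\|F(x)-F(z)-F'(z)(x-z)\|\le c\,D(x,z)$, and there are $x^\dagger\in X$, $\omega\in Y$ such that $F(x^\dagger)=y$, $f_p(x^\dagger)=\min\{f_p(x):F(x)=y\}$,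 $\|\omega\|\le\varrho$ and $J_p(x^\dagger)=F'(x^\dagger)^*\omega$. **Constants.** Let $\tilde c_p$ be a constant with $D(z,x)\le\tilde c_p\|x-z\|^p$ for all $x,z\in X$, and put $$\alpha_*=\frac{\delta}{(s-2)\varrho},\quad A=\Big(\frac p{2\alpha_*}\Big)^{1/p}\|F(0)-y^\delta\|^{2/p},\quad K=LA+\|F'(0)\|,\quad \gamma=\frac{1-sc\varrho}2,$$ $$r_\alpha=\frac2{1+\sqrt2}\min\Big\{\frac{\gamma\alpha}{csK},\sqrt{\frac{\gamma\alpha}{10cL}}\Big\},\quad c_A=\frac{p-1}2(3A)^{p-2},\quad \bar c_A=\bar c_A(\alpha)=\frac{p-1}2(2r_\alpha+A)^{p-2},$$ $$\sigma=\frac{2s\varrho K}{c_A(1-sc\varrho)\alpha_*},\quad \bar q_0=\frac{2sc\varrho}{1+sc\varrho}.$$ Assume $K>0$; if $A=0$ and $p<2$, read $\sigma=0$. For $\alpha\ge\alpha_*$ let $x_\alpha^\delta$ be a global minimizer of $\Phi_\alpha$, and let $d:\alpha\mapsto d_\alpha$ be any function that on $[\alpha_*,\infty)$ is positive, continuous and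 strictly increasing, tends to $\infty$ as $\alpha\to\infty$, and satisfies $$\mathcal B_{d_\alpha}(x_\alpha^\delta):=\{x\in X: D(x_\alpha^\delta,x)\le d_\alpha\}\subset\{x\in X:\|x-x_\alpha^\delta\|\le r_\alpha\}\qquad(\alpha\ge\alpha_*).$$ For $C>0$ put further $$\tilde c_q(\alpha)=\max\Big\{1,\tfrac{q-1}2\big(2(r_\alpha+A)^{p-1}+r_\alpha\big)^{q-2}\Big\},\qquad T_\alpha=\frac{r_\alpha}{\tilde c_q(\alpha)C},$$ $$\kappa_\alpha=(Lr_\alpha+K)\big(cd_\alpha+(Lr_\alpha+K)r_\alpha+s\varrho\alpha\big)+\alpha(r_\alpha+A)^{p-1},$$ $$c_p(\alpha)=\tfrac{p-1}2\Big(3\big((r_\alpha+A)^{p-1}+T_\alpha\kappa_\alpha\big)^{q-1}\Big)^{p-2},$$ $$\underline M_\alpha(C)=\max\Big\{\frac1{2T_\alpha},\ \frac{c^2T_\alpha^2\kappa_\alpha^2}{2c_p(\alpha)}+\frac{(Lr_\alpha+K)^2}{c_p(\alpha)}+c\big(cd_\alpha+(Lr_\alpha+K)r_\alpha+s\varrho\alpha\big)+\alpha\Big\}.$$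 **Choice of parameters.** Let $\bar x_0\in X$, $\alpha_0\ge\alpha_*$, $\bar q\in(\bar q_0,1)$, $\alpha_j=\bar q^j\alpha_0$, and suppose 1. $D(x_{\alpha_0}^\delta,\bar x_0)\le d_{\alpha_0}$; 2. $\rho\,\sigma\,\alpha_0(1-\bar q)\le\min\{d_{\alpha_*}/3,1\}$, where $\rho=\max\{\tilde c_p^{1/p},\,2A^{p-1}+r_{\alpha_0}^{p-1}\}$; 3. for all $j$ with $\alpha_j\ge\alpha_*$, with $\bar c_A=\bar c_A(\alpha_j)$, $$0<C_{\alpha_j}\le\gamma\alpha_j\min\Big\{\frac{d_{\max\{\alpha_{j+1},\alpha_*\}}}{3r_{\alpha_j}},\frac{\delta\,\bar c_A}{K+r_{\alpha_j}(c\,\bar c_A+L)}\Big\}\quad\text{and}\quad M_{\alpha_j}\ge\underline M_{\alpha_j}(C_{\alpha_j});$$ 4. $\tau=2+\dfrac2{\bar q(s-2)}$. **Algorithm (d-TIGRA).** Start with $x_{0,0}=\bar x_0$. At level $j$ iterate $$x_{j,k+1}=J_q\big(J_p(x_{j,k})-\beta_{j,k}\nabla\Phi_{\alpha_j}(x_{j,k})\big),\qquad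 \beta_{j,k}=\min\Big\{\frac{\gamma\,\bar c_{j,k}\,\alpha_j}{\|\nabla\Phi_{\alpha_j}(x_{j,k})\|^2},\frac1{2M_{\alpha_j}}\Big\},$$ $$\bar c_{j,k}=\min\Big\{1,\frac{8\bar c_A\,(\Phi_{\alpha_j}(x_{j,k})-\phi_{j,k})}{4K^2+4Ls\varrho\alpha_j+4LKr_{\alpha_j}+L^2r_{\alpha_j}^2+8\alpha_j\tilde c_p\bar c_A^{(2-p)/2}}\Big\},$$ $$\phi_{j,k}=\inf_{t>0}\Phi_{\alpha_j}\big(J_q(J_p(x_{j,k})-t\nabla\Phi_{\alpha_j}(x_{j,k}))\big),$$ until the first index $k=k^*(j)$ with $\|\nabla\Phi_{\alpha_j}(x_{j,k})\|\le C_{\alpha_j}$. If $\|F(x_{j,k^*(j)})-y^\delta\|\le\tau\delta$, stop with $j^*=j$; otherwise go to level $j+1$ with $x_{j+1,0}=x_{j,k^*(j)}$. **Proposition.** The algorithm terminates after finitely many outer steps: there is a first level $j^*$ at which $\|F(x_{j^*,k^*(j^*)})-y^\delta\|\le\tau\delta$, and for every $j\le j^*$ the inner iteration at level $j$ stops after finitely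 many steps. The final parameter satisfies $\alpha_{j^*}\ge\alpha_*=\delta/((s-2)\varrho)$, and all generated iterates remain in the region of convergence: $x_{j,k}\in\mathcal B_{d_{\alpha_j}}(x_{\alpha_j}^\delta)$, i.e. $D(x_{\alpha_j}^\delta,x_{j,k})\le d_{\alpha_j}$, for all $j\le j^*$ and $0\le k\le k^*(j)$. -/

import Mathlib

open scoped ENNReal

noncomputable section

namespace TIGRA

instance factOneLe (p : ℝ) [hp : Fact (1 < p)] : Fact (1 ≤ ENNReal.ofReal p) :=
  ⟨by simpa using ENNReal.ofReal_le_ofReal hp.out.le⟩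

/-- The real sequence space `ℓ^p` over `ℕ`. -/
abbrev ellp (p : ℝ) : Type := lp (fun _ : ℕ => ℝ) (ENNReal.ofReal p)

/-- The signed power `|t| ^ r * sgn t`. -/
def sgnPow (r t : ℝ) : ℝ := |t| ^ r * Real.sign t

theorem abs_sgnPow_le (r t : ℝ) : |sgnPow r t| ≤ |t| ^ r := by
  have h0 : 0 ≤ |t| ^ r := Real.rpow_nonneg (abs_nonneg t) r
  rw [sgnPow, abs_mul, abs_of_nonneg h0]
  rcases Real.sign_apply_eq t with h | h | h <;> rw [h] <;> simp [h0]

theorem toReal_ofReal_exp {p : ℝ} [hp : Fact (1 < p)] : (ENNReal.ofReal p).toReal = p :=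
  ENNReal.toReal_ofReal (by linarith [hp.out])

theorem holderConj {p : ℝ} [hp : Fact (1 < p)] : p.HolderConjugate (Real.conjExponent p) :=
  Real.HolderConjugate.conjExponent hp.out

theorem sub_one_mul_conj {p : ℝ} [hp : Fact (1 < p)] : (p - 1) * Real.conjExponent p = p := by
  have : p - 1 ≠ 0 := by linarith [hp.out]
  rw [Real.conjExponent]; field_simp

theorem conj_sub_one_mul {p : ℝ} [hp : Fact (1 < p)] :
    (Real.conjExponent p - 1) * p = Real.conjExponent p := by
  have : p - 1 ≠ 0 := by linarith [hp.out]
  rw [Real.conjExponent]; field_simp; ring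

theorem hasSum_abs_rpow {p : ℝ} [hp : Fact (1 < p)] (x : ellp p) :
    HasSum (fun i => |x i| ^ p) (‖x‖ ^ p) := by
  have hp0 : 0 < (ENNReal.ofReal p).toReal := by
    rw [toReal_ofReal_exp]; linarith [hp.out]
  have h := lp.hasSum_norm hp0 x
  rw [toReal_ofReal_exp] at h
  simpa [Real.norm_eq_abs] using h

theorem duality_bound {p : ℝ} [hp : Fact (1 < p)] (x z : ellp p) :
    (Summable fun i => sgnPow (p - 1) (x i) * z i) ∧
      |∑' i, sgnPow (p - 1) (x i) * z i| ≤ ‖x‖ ^ (p - 1) * ‖z‖ := by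
  have hx := hasSum_abs_rpow x
  have hz := hasSum_abs_rpow z
  have hx' : HasSum (fun i => (|x i| ^ (p - 1)) ^ Real.conjExponent p)
      ((‖x‖ ^ (p - 1)) ^ Real.conjExponent p) := by
    simpa only [← Real.rpow_mul (abs_nonneg _), ← Real.rpow_mul (norm_nonneg _),
      sub_one_mul_conj] using hx
  obtain ⟨S, -, hS, hsum⟩ := Real.inner_le_Lp_mul_Lq_hasSum_of_nonneg
    (holderConj (p := p)).symm (Real.rpow_nonneg (norm_nonneg x) (p - 1)) (norm_nonneg z)
    (fun i => Real.rpow_nonneg (abs_nonneg (x i)) (p - 1)) (fun i => abs_nonneg (z i)) hx' hz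
  have hle : ∀ i, ‖sgnPow (p - 1) (x i) * z i‖ ≤ |x i| ^ (p - 1) * |z i| := fun i => by
    rw [Real.norm_eq_abs, abs_mul]
    exact mul_le_mul_of_nonneg_right (abs_sgnPow_le _ _) (abs_nonneg _)
  refine ⟨Summable.of_norm_bounded hsum.summable hle, ?_⟩
  have h := tsum_of_norm_bounded hsum hle
  rw [Real.norm_eq_abs] at h
  exact h.trans hS

/-- The duality mapping `J_p : ℓ^p → (ℓ^p)^*` with gauge `t ↦ t ^ (p - 1)`, that is,
`⟨J_p x, z⟩ = ∑ i, |x i| ^ (p - 1) * sgn (x i) * z i`. -/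
def Jp {p : ℝ} [Fact (1 < p)] (x : ellp p) : StrongDual ℝ (ellp p) :=
  LinearMap.mkContinuous
    { toFun := fun z => ∑' i, sgnPow (p - 1) (x i) * z i
      map_add' := fun z w => by
        rw [← (duality_bound x z).1.tsum_add (duality_bound x w).1]
        exact tsum_congr fun i => by simp [mul_add]
      map_smul' := fun a z => by
        rw [RingHom.id_apply, smul_eq_mul, ← tsum_mul_left]
        exact tsum_congr fun i => by simp [mul_left_comm] }
    (‖x‖ ^ (p - 1)) (fun z => (duality_bound x z).2)

/-- The coordinates `ξ e_i` of a functional `ξ` on `ℓ^p` under the identification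
`(ℓ^p)^* = ℓ^q`. -/
def coord {p : ℝ} [Fact (1 < p)] (ξ : StrongDual ℝ (ellp p)) (i : ℕ) : ℝ :=
  ξ (lp.single (ENNReal.ofReal p) i (1 : ℝ))

theorem sgnPow_mul_self {q : ℝ} (hq : 0 < q) (t : ℝ) : sgnPow (q - 1) t * t = |t| ^ q := by
  rcases eq_or_ne t 0 with rfl | ht
  · simp [Real.zero_rpow hq.ne']
  · have h1 : Real.sign t * t = |t| := by
      rcases lt_or_gt_of_ne ht with h | h
      · rw [Real.sign_of_neg h, abs_of_neg h]; ring
      · rw [Real.sign_of_pos h, abs_of_pos h]; ring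
    rw [sgnPow, mul_assoc, h1, Real.rpow_sub_one (abs_ne_zero.mpr ht)]
    field_simp

theorem memlp_dual {p : ℝ} [hp : Fact (1 < p)] (ξ : StrongDual ℝ (ellp p)) :
    Memℓp (fun i => sgnPow (Real.conjExponent p - 1) (coord ξ i)) (ENNReal.ofReal p) := by
  set q := Real.conjExponent p with hq
  have hpq : p.HolderConjugate q := holderConj
  have hp0 : 0 < p := by linarith [hp.out]
  have hq0 : 0 < q := hpq.symm.pos
  refine memℓp_gen' (C := ‖ξ‖ ^ q) fun s => ?_
  rw [toReal_ofReal_exp]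
  have hle : ∀ i, ‖sgnPow (q - 1) (coord ξ i)‖ ^ p ≤ |coord ξ i| ^ q := fun i => by
    calc ‖sgnPow (q - 1) (coord ξ i)‖ ^ p ≤ (|coord ξ i| ^ (q - 1)) ^ p := by
          rw [Real.norm_eq_abs]
          exact Real.rpow_le_rpow (abs_nonneg _) (abs_sgnPow_le _ _) hp0.le
      _ = |coord ξ i| ^ q := by
          rw [← Real.rpow_mul (abs_nonneg _), hq, conj_sub_one_mul]
  refine (Finset.sum_le_sum fun i _ => hle i).trans ?_
  set S := ∑ i ∈ s, |coord ξ i| ^ q with hS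
  have hS0 : 0 ≤ S := Finset.sum_nonneg fun i _ => Real.rpow_nonneg (abs_nonneg _) _
  rcases hS0.eq_or_lt with h0 | h0
  · rw [← h0]; exact Real.rpow_nonneg (norm_nonneg _) _
  set v : ellp p := ∑ i ∈ s, lp.single (ENNReal.ofReal p) i (sgnPow (q - 1) (coord ξ i)) with hv
  have hξv : ξ v = S := by
    rw [hv, map_sum, hS]
    refine Finset.sum_congr rfl fun i _ => ?_
    have : lp.single (E := fun _ : ℕ => ℝ) (ENNReal.ofReal p) i (sgnPow (q - 1) (coord ξ i))
        = sgnPow (q - 1) (coord ξ i) • lp.single (ENNReal.ofReal p) i (1 : ℝ) := by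
      rw [← lp.single_smul]; simp
    rw [this, map_smul, smul_eq_mul]
    exact sgnPow_mul_self hq0 _
  have hvn : ‖v‖ ^ p ≤ S := by
    have h := lp.norm_sum_single (E := fun _ : ℕ => ℝ) (p := ENNReal.ofReal p)
      (by rw [toReal_ofReal_exp]; exact hp0) (fun i => sgnPow (q - 1) (coord ξ i)) s
    rw [toReal_ofReal_exp] at h
    rw [hv, h]
    exact Finset.sum_le_sum fun i _ => hle i
  have h1 : S ≤ ‖ξ‖ * S ^ (1 / p) := by
    calc S = ξ v := hξv.symm
      _ ≤ ‖ξ‖ * ‖v‖ := (le_abs_self _).trans (ξ.le_opNorm v)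
      _ ≤ ‖ξ‖ * S ^ (1 / p) := by
          refine mul_le_mul_of_nonneg_left ?_ (norm_nonneg _)
          calc ‖v‖ = (‖v‖ ^ p) ^ (1 / p) := by
                rw [← Real.rpow_mul (norm_nonneg _), mul_one_div_cancel hp0.ne', Real.rpow_one]
            _ ≤ S ^ (1 / p) := Real.rpow_le_rpow (Real.rpow_nonneg (norm_nonneg _) _) hvn
                (by positivity)
  have h2 : S ^ (1 / q) ≤ ‖ξ‖ := by
    have h3 : S ^ (1 / q) * S ^ (1 / p) = S := by
      rw [← Real.rpow_add h0]
      have : 1 / q + 1 / p = 1 := by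
        have := hpq.inv_add_inv_eq_one
        rw [one_div, one_div]; linarith
      rw [this, Real.rpow_one]
    have h4 : 0 < S ^ (1 / p) := Real.rpow_pos_of_pos h0 _
    exact le_of_mul_le_mul_right (by rw [h3]; exact h1) h4
  calc S = (S ^ (1 / q)) ^ q := by
        rw [← Real.rpow_mul hS0, one_div_mul_cancel hq0.ne', Real.rpow_one]
    _ ≤ ‖ξ‖ ^ q := Real.rpow_le_rpow (Real.rpow_nonneg hS0 _) h2 hq0.le

/-- The duality mapping `J_q : (ℓ^p)^* = ℓ^q → ℓ^p`, `(J_q ξ)_i = |ξ_i| ^ (q - 1) * sgn ξ_i`,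
where `1 / p + 1 / q = 1`. -/
def Jq {p : ℝ} [Fact (1 < p)] (ξ : StrongDual ℝ (ellp p)) : ellp p :=
  ⟨fun i => sgnPow (Real.conjExponent p - 1) (coord ξ i), memlp_dual ξ⟩

/-- The penalty `f_p x = ‖x‖ ^ p / p`. -/
def fp {p : ℝ} [Fact (1 < p)] (x : ellp p) : ℝ := 1 / p * ‖x‖ ^ p

/-- The Bregman distance `D_{f_p}(z, x)`. -/
def breg {p : ℝ} [Fact (1 < p)] (z x : ellp p) : ℝ := fp z - fp x - Jp x (z - x)

/-- The data of the problem and the numerical constants: the operator `F`, the noisy data, the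
noise level, the constants `L`, `c`, `s`, `ϱ` of the assumption below, and the constant `cpt` in
the estimate `D_{f_p}(z, x) ≤ cpt * ‖x - z‖ ^ p`. -/
structure Problem (p : ℝ) [Fact (1 < p)] (Y : Type*) [NormedAddCommGroup Y]
    [InnerProductSpace ℝ Y] where
  F : ellp p → Y
  ydelta : Y
  delta : ℝ
  L : ℝ
  c : ℝ
  s : ℝ
  rho : ℝ
  cpt : ℝ

namespace Problem

variable {p : ℝ} [Fact (1 < p)] {Y : Type*} [NormedAddCommGroup Y] [InnerProductSpace ℝ Y]

/-- The Lipschitz condition on `F'`, the nonlinearity condition and the source condition at some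
`f_p`-minimizing solution of `F x = y`. -/
structure Assumption (P : Problem p Y) (y : Y) : Prop where
  differentiable : Differentiable ℝ P.F
  L_pos : 0 < P.L
  lipschitz : ∀ x z : ellp p, ‖fderiv ℝ P.F x - fderiv ℝ P.F z‖ ≤ P.L * ‖x - z‖
  c_pos : 0 < P.c
  nonlinearity : ∀ x z : ellp p,
    ‖P.F x - P.F z - fderiv ℝ P.F z (x - z)‖ ≤ P.c * breg x z
  s_gt : 2 < P.s
  rho_pos : 0 < P.rho
  rho_lt : P.rho < 1 / (P.s * P.c)
  source : ∃ (xdag : ellp p) (ω : Y),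
    P.F xdag = y ∧ (∀ x : ellp p, P.F x = y → fp xdag ≤ fp x) ∧
    ‖ω‖ ≤ P.rho ∧ Jp xdag = (innerSL ℝ ω).comp (fderiv ℝ P.F xdag)

/-- The Tikhonov functional `Φ_α`. -/
def Phi (P : Problem p Y) (α : ℝ) (x : ellp p) : ℝ :=
  1 / 2 * ‖P.F x - P.ydelta‖ ^ 2 + α * fp x

/-- The gradient `∇Φ_α(x) = F'(x)^* (F x - y^δ) + α J_p(x)`, an element of `(ℓ^p)^*`. -/
def gradPhi (P : Problem p Y) (α : ℝ) (x : ellp p) : StrongDual ℝ (ellp p) :=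
  (innerSL ℝ (P.F x - P.ydelta)).comp (fderiv ℝ P.F x) + α • Jp x

/-- `α_* = δ / ((s - 2) ϱ)`. -/
def alphaStar (P : Problem p Y) : ℝ := P.delta / ((P.s - 2) * P.rho)

/-- The constant `A`. -/
def A (P : Problem p Y) : ℝ :=
  (p / (2 * P.alphaStar)) ^ (1 / p) * ‖P.F 0 - P.ydelta‖ ^ (2 / p)

/-- The constant `K`. -/
def K (P : Problem p Y) : ℝ := P.L * P.A + ‖fderiv ℝ P.F 0‖

/-- The constant `γ`. -/
def gam (P : Problem p Y) : ℝ := (1 - P.s * P.c * P.rho) / 2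

/-- The radius `r_α` of the ball of directional convexity. -/
def r (P : Problem p Y) (α : ℝ) : ℝ :=
  2 / (1 + √2) *
    min (P.gam * α / (P.c * P.s * P.K)) (√(P.gam * α / (10 * P.c * P.L)))

/-- The constant `c_A`. -/
def cA (P : Problem p Y) : ℝ := (p - 1) / 2 * (3 * P.A) ^ (p - 2)

/-- The constant `c̄_A`, which depends on `α`. -/
def cAbar (P : Problem p Y) (α : ℝ) : ℝ := (p - 1) / 2 * (2 * P.r α + P.A) ^ (p - 2)

/-- The constant `σ`. -/
def sigma (P : Problem p Y) : ℝ :=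
  2 * P.s * P.rho * P.K / (P.cA * (1 - P.s * P.c * P.rho) * P.alphaStar)

/-- The constant `q̄₀`. -/
def qbar0 (P : Problem p Y) : ℝ := 2 * P.s * P.c * P.rho / (1 + P.s * P.c * P.rho)

/-- The constant `ρ = max {c̃_p ^ (1/p), 2 A ^ (p-1) + r_{α₀} ^ (p-1)}`. -/
def rhoMax (P : Problem p Y) (α₀ : ℝ) : ℝ :=
  max (P.cpt ^ (1 / p)) (2 * P.A ^ (p - 1) + P.r α₀ ^ (p - 1))

/-- `xm α` is a global minimizer of `Φ_α` for every `α ≥ α_*`. -/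
def IsMinimizerFamily (P : Problem p Y) (xm : ℝ → ellp p) : Prop :=
  ∀ α, P.alphaStar ≤ α → ∀ x, P.Phi α (xm α) ≤ P.Phi α x

/-- Admissible radii `d_α` of the regions of convergence: the Bregman ball of radius `d_α` around
the minimizer is contained in the norm ball of radius `r_α`, and `d_α` is positive, continuous,
strictly increasing and unbounded. -/
structure IsRegionRadius (P : Problem p Y) (xm : ℝ → ellp p) (d : ℝ → ℝ) : Prop where
  pos : ∀ α, P.alphaStar ≤ α → 0 < d α
  ball_subset : ∀ α, P.alphaStar ≤ α → ∀ x, breg (xm α) x ≤ d α → ‖x - xm α‖ ≤ P.r α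
  continuousOn : ContinuousOn d (Set.Ici P.alphaStar)
  strictMonoOn : StrictMonoOn d (Set.Ici P.alphaStar)
  tendsto : Filter.Tendsto d Filter.atTop Filter.atTop

/-- The constant `c̃_q(α)`. -/
def cqt (P : Problem p Y) (α : ℝ) : ℝ :=
  max 1 ((Real.conjExponent p - 1) / 2 *
    (2 * (P.r α + P.A) ^ (p - 1) + P.r α) ^ (Real.conjExponent p - 2))

/-- The bound `κ_α` for the gradient on the region of convergence with radius `dα`. -/
def kappa (P : Problem p Y) (α dα : ℝ) : ℝ :=
  (P.L * P.r α + P.K) *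
      (P.c * dα + (P.L * P.r α + P.K) * P.r α + P.s * P.rho * α) +
    α * (P.r α + P.A) ^ (p - 1)

/-- The constant `T_α`, for the inner tolerance `C`. -/
def T (P : Problem p Y) (α C : ℝ) : ℝ := P.r α / (P.cqt α * C)

/-- The constant `c_p(α)`. -/
def cpAlpha (P : Problem p Y) (α dα C : ℝ) : ℝ :=
  (p - 1) / 2 *
    (3 * ((P.r α + P.A) ^ (p - 1) + P.T α C * P.kappa α dα) ^ (Real.conjExponent p - 1)) ^ (p - 2)

/-- The lower bound for the constants `M_α` in the step sizes. -/
def Mmin (P : Problem p Y) (α dα C : ℝ) : ℝ :=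
  max (1 / (2 * P.T α C))
    (P.c ^ 2 * P.T α C ^ 2 * P.kappa α dα ^ 2 / (2 * P.cpAlpha α dα C) +
      (P.L * P.r α + P.K) ^ 2 / P.cpAlpha α dα C +
      P.c * (P.c * dα + (P.L * P.r α + P.K) * P.r α + P.s * P.rho * α) + α)

/-- One dual gradient step `x ↦ J_q (J_p x - β ∇Φ_α(x))`. -/
def dualStep (P : Problem p Y) (α β : ℝ) (x : ellp p) : ellp p :=
  Jq (Jp x - β • P.gradPhi α x)

/-- The value `φ` of the line search along the dual descent curve. -/
def phiMin (P : Problem p Y) (α : ℝ) (x : ellp p) : ℝ :=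
  sInf ((fun t => P.Phi α (P.dualStep α t x)) '' Set.Ioi 0)

/-- The constant `c̄_{j,k}` at the level `α` and the iterate `x`. -/
def cbar (P : Problem p Y) (α : ℝ) (x : ellp p) : ℝ :=
  min 1 (8 * P.cAbar α * (P.Phi α x - P.phiMin α x) /
    (4 * P.K ^ 2 + 4 * P.L * P.s * P.rho * α + 4 * P.L * P.K * P.r α + P.L ^ 2 * P.r α ^ 2 +
      8 * α * P.cpt * P.cAbar α ^ ((2 - p) / 2)))

/-- The step size `β_{j,k}` at the level `α` and the iterate `x`. -/
def stepSize (P : Problem p Y) (α M : ℝ) (x : ellp p) : ℝ :=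
  min (P.gam * P.cbar α x * α / ‖P.gradPhi α x‖ ^ 2) (1 / (2 * M))

/-- The inner iteration at the level `α`. -/
def inner (P : Problem p Y) (α M : ℝ) (x₀ : ellp p) : ℕ → ellp p
  | 0 => x₀
  | k + 1 => P.dualStep α (P.stepSize α M (P.inner α M x₀ k)) (P.inner α M x₀ k)

/-- The inner stopping rule, `‖∇Φ_α(x)‖ ≤ C`. -/
def InnerStop (P : Problem p Y) (α C : ℝ) (x : ellp p) : Prop := ‖P.gradPhi α x‖ ≤ C

/-- The index of the first inner iterate which satisfies the inner stopping rule (only meaningful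
if there is one). -/
def kStop (P : Problem p Y) (α C M : ℝ) (x₀ : ellp p) : ℕ :=
  sInf {k | P.InnerStop α C (P.inner α M x₀ k)}

/-- The parameters of the algorithm: starting value, initial regularization parameter, decrease
factor, inner tolerances `C_{α_j}` and step size constants `M_{α_j}`. -/
structure Param (p : ℝ) where
  xbar : ellp p
  alpha0 : ℝ
  qbar : ℝ
  C : ℕ → ℝ
  M : ℕ → ℝ

/-- The regularization parameter `α_j = q̄ ^ j * α₀`. -/
def Param.alpha (Q : Param p) (j : ℕ) : ℝ := Q.qbar ^ j * Q.alpha0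

/-- The constant `τ` of the discrepancy principle. -/
def tau (P : Problem p Y) (Q : Param p) : ℝ := 2 + 2 / (Q.qbar * (P.s - 2))

/-- The choice of the parameters of the algorithm. The value `α_{j+1}` in the bound for `C_{α_j}`
is replaced by `α_*` when it drops below `α_*`. The step sizes themselves are given by
`stepSize`, and `τ` by `tau`. -/
structure ParamChoice (P : Problem p Y) (xm : ℝ → ellp p) (d : ℝ → ℝ) (Q : Param p) : Prop where
  alpha0_ge : P.alphaStar ≤ Q.alpha0
  init : breg (xm Q.alpha0) Q.xbar ≤ d Q.alpha0
  qbar_gt : P.qbar0 < Q.qbar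
  qbar_lt : Q.qbar < 1
  qbar_cond : P.rhoMax Q.alpha0 * P.sigma * Q.alpha0 * (1 - Q.qbar) ≤ min (d P.alphaStar / 3) 1
  C_pos : ∀ j, P.alphaStar ≤ Q.alpha j → 0 < Q.C j
  C_le : ∀ j, P.alphaStar ≤ Q.alpha j →
    Q.C j ≤ P.gam * Q.alpha j *
      min (d (max (Q.alpha (j + 1)) P.alphaStar) / (3 * P.r (Q.alpha j)))
        (P.delta * P.cAbar (Q.alpha j) /
          (P.K + P.r (Q.alpha j) * (P.c * P.cAbar (Q.alpha j) + P.L)))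
  M_ge : ∀ j, P.alphaStar ≤ Q.alpha j → P.Mmin (Q.alpha j) (d (Q.alpha j)) (Q.C j) ≤ Q.M j

/-- The starting value `x_{j,0}` of the `j`-th inner iteration: `x_{0,0}` is the starting value of
the algorithm and `x_{j+1,0}` is the last iterate at level `j`. -/
def start (P : Problem p Y) (Q : Param p) : ℕ → ellp p
  | 0 => Q.xbar
  | j + 1 => P.inner (Q.alpha j) (Q.M j) (P.start Q j)
      (P.kStop (Q.alpha j) (Q.C j) (Q.M j) (P.start Q j))

/-- The iterates `x_{j,k}` of the dual TIGRA algorithm. -/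
def iter (P : Problem p Y) (Q : Param p) (j k : ℕ) : ellp p :=
  P.inner (Q.alpha j) (Q.M j) (P.start Q j) k

/-- The index `k^*(j)` of the last iterate at level `j`. -/
def kstar (P : Problem p Y) (Q : Param p) (j : ℕ) : ℕ :=
  P.kStop (Q.alpha j) (Q.C j) (Q.M j) (P.start Q j)

/-- The outer stopping rule (discrepancy principle) at level `j`. -/
def OuterStop (P : Problem p Y) (Q : Param p) (j : ℕ) : Prop :=
  ‖P.F (P.iter Q j (P.kstar Q j)) - P.ydelta‖ ≤ P.tau Q * P.delta

end Problem

end TIGRA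

end

/-! ### Scalar inequalities for signed powers -/

namespace TIGRA

/-! Fix a level with α ≥ α_* and let u be the minimizer of Φ_α. Testing minimality against x† and
using the source condition gives ‖F u − y^δ‖ ≤ δ + 2ϱα ≤ sϱα. As scϱ < 1, the penalty dominates the
nonlinearity remainder. Hence Φ_α grows by at least 2γα D(·, u) away from u (`growth`), and on the
ball of radius r_α it is convex towards u with a gain γα D(u, x) (`le_gradPhi_apply`).

In the variable J_p x the iteration is a plain gradient step, and the lower bound on M makes Φ_α
relatively smooth along it (`Phi_dualStep_le`). The three point identity combines convexity and
smoothness: D(u, ·) does not increase, so the iterates stay in the Bregman ball. While the gradient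
norm exceeds C, the step sizes are bounded below and every step lowers the nonnegative Φ_α by a
fixed amount, so the inner loop is finite.

When it stops, coercivity and the first bound on C give D(u, x) ≤ d/3, with d the next radius. The
minimizers are Lipschitz in α with constant σ, because adding two growth inequalities cancels the
residuals. The condition on q̄ then bounds by d/3 each of the two error terms caused by replacing u
with the next minimizer, so x lies in the next region (`breg_minimizer_le`).

At the last level with α_j ≥ α_* one has ϱα_j ≤ δ/(q̄(s − 2)), and the second bound on C gives ‖F x
− F u‖ ≤ δ. The residual is therefore at most 2δ + 2ϱα_j ≤ τδ, and the first stopping level comes no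
later than this one.

The analytic basis is `breg_ge`, a quadratic lower bound for D on bounded sets with an explicit
constant. -/

theorem sgnPow_zero {r : ℝ} : sgnPow r 0 = 0 := by simp [sgnPow]

theorem sgnPow_of_nonneg {r t : ℝ} (hr : 0 < r) (ht : 0 ≤ t) : sgnPow r t = t ^ r := by
  rcases ht.eq_or_lt with rfl | h
  · rw [sgnPow_zero, Real.zero_rpow hr.ne']
  · rw [sgnPow, Real.sign_of_pos h, abs_of_pos h, mul_one]

theorem sgnPow_neg (r t : ℝ) : sgnPow r (-t) = -sgnPow r t := by
  simp [sgnPow, Real.sign_neg]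

/-- Signed powers with inverse exponents are inverse to each other. -/
theorem sgnPow_sgnPow {a b : ℝ} (ha : 0 < a) (hb : 0 < b) (hab : b * a = 1) (t : ℝ) :
    sgnPow a (sgnPow b t) = t := by
  have key : ∀ t : ℝ, 0 ≤ t → sgnPow a (sgnPow b t) = t := fun t ht => by
    rw [sgnPow_of_nonneg hb ht, sgnPow_of_nonneg ha (Real.rpow_nonneg ht b),
      ← Real.rpow_mul ht, hab, Real.rpow_one]
  rcases le_total 0 t with ht | ht
  · exact key t ht
  · have := key (-t) (by linarith)
    rw [sgnPow_neg, sgnPow_neg] at this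
    linarith

/-- On `[-w, w]` the signed power with exponent `r ∈ (0, 1]` has slope at least `r * w ^ (r - 1)`. -/
theorem slope_le_sgnPow_sub {r w a b : ℝ} (hr : 0 < r) (hr1 : r ≤ 1)
    (ha : -w ≤ a) (hab : a ≤ b) (hb : b ≤ w) :
    r * w ^ (r - 1) * (b - a) ≤ sgnPow r b - sgnPow r a := by
  have pos : ∀ a b : ℝ, 0 ≤ a → a ≤ b → b ≤ w →
      r * w ^ (r - 1) * (b - a) ≤ sgnPow r b - sgnPow r a := fun a b h0 h1 h2 => by
    rw [sgnPow_of_nonneg hr h0, sgnPow_of_nonneg hr (h0.trans h1)]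
    rcases (h0.trans h1).eq_or_lt with rfl | hb0
    · have : a = 0 := le_antisymm h1 h0
      simp [this]
    -- Bernoulli's inequality: the tangent of the concave power at b lies above it. The slope r * b
    -- ^ (r - 1) is at least r * w ^ (r - 1) because r ≤ 1.
    have h3 : (1 + (a - b) / b) ^ r ≤ 1 + r * ((a - b) / b) := by
      refine rpow_one_add_le_one_add_mul_self ?_ hr.le hr1
      rw [le_div_iff₀ hb0]; linarith
    have h4 : 1 + (a - b) / b = a / b := by field_simp; ring
    rw [h4, Real.div_rpow h0 hb0.le, div_le_iff₀ (Real.rpow_pos_of_pos hb0 r)] at h3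
    have h5 : w ^ (r - 1) ≤ b ^ (r - 1) :=
      Real.rpow_le_rpow_of_nonpos hb0 h2 (by linarith)
    have h6 : b ^ r = b ^ (r - 1) * b := by
      rw [Real.rpow_sub_one hb0.ne']; field_simp
    have h7 : (1 + r * ((a - b) / b)) * b ^ r = b ^ r - r * b ^ (r - 1) * (b - a) := by
      rw [h6]; field_simp; ring
    rw [h7] at h3
    have h8 : r * w ^ (r - 1) * (b - a) ≤ r * b ^ (r - 1) * (b - a) :=
      mul_le_mul_of_nonneg_right (mul_le_mul_of_nonneg_left h5 hr.le) (by linarith)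
    linarith
  have neg : ∀ a b : ℝ, b ≤ 0 → a ≤ b → -w ≤ a →
      r * w ^ (r - 1) * (b - a) ≤ sgnPow r b - sgnPow r a := fun a b h0 h1 h2 => by
    have := pos (-b) (-a) (by linarith) (by linarith) (by linarith)
    rw [sgnPow_neg, sgnPow_neg] at this
    linarith
  rcases le_total 0 a with h0 | h0
  · exact pos a b h0 hab hb
  rcases le_total b 0 with h1 | h1
  · exact neg a b h1 hab ha
  have h2 := pos 0 b le_rfl h1 hb
  have h3 := neg a 0 le_rfl h0 ha
  linarith

theorem sgnPow_sub_one_eq {p : ℝ} (t : ℝ) : sgnPow (p - 1) t = |t| ^ (p - 2) * t := by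
  rcases eq_or_ne t 0 with rfl | ht
  · simp [sgnPow_zero]
  have h0 : |t| ≠ 0 := abs_ne_zero.mpr ht
  have h1 : |t| * Real.sign t = t := by
    rcases lt_or_gt_of_ne ht with h | h
    · rw [Real.sign_of_neg h, abs_of_neg h]; ring
    · rw [Real.sign_of_pos h, abs_of_pos h]; ring
  have h2 : |t| ^ (p - 1) = |t| ^ (p - 2) * |t| := by
    rw [show p - 1 = (p - 2) + 1 by ring, Real.rpow_add_one h0]
  rw [sgnPow, h2, mul_assoc, h1]

/-- Strong convexity of `t ↦ |t| ^ p / p` on `[-w, w]`. -/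
theorem scalar_breg_ge {p w x z : ℝ} (hp1 : 1 < p) (hp2 : p ≤ 2) (hx : |x| ≤ w) (hz : |z| ≤ w) :
    (p - 1) / 2 * w ^ (p - 2) * (z - x) ^ 2 ≤
      1 / p * |z| ^ p - 1 / p * |x| ^ p - sgnPow (p - 1) x * (z - x) := by
  have hp0 : 0 < p := by linarith
  set k := (p - 1) * w ^ (p - 2) with hk
  -- Subtracting the quadratic leaves a function with monotone derivative on [-w, w], by the slope
  -- bound; its tangent inequality at x is the claim.
  set f : ℝ → ℝ := fun t => 1 / p * |t| ^ p - k / 2 * t ^ 2 with hf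
  have hderiv : ∀ t, HasDerivAt f (sgnPow (p - 1) t - k * t) t := fun t => by
    have h1 := ((hasDerivAt_abs_rpow t hp1).const_mul (1 / p)).sub
      ((hasDerivAt_pow 2 t).const_mul (k / 2))
    refine h1.congr_deriv ?_
    rw [sgnPow_sub_one_eq]
    field_simp
    ring
  have hconv : ConvexOn ℝ (Set.Icc (-w) w) f := by
    refine MonotoneOn.convexOn_of_deriv (convex_Icc _ _)
      (fun t _ => (hderiv t).continuousAt.continuousWithinAt)
      (fun t _ => (hderiv t).differentiableAt.differentiableWithinAt) ?_
    rw [interior_Icc]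
    intro a ha b hb hab
    rw [(hderiv a).deriv, (hderiv b).deriv]
    have h := slope_le_sgnPow_sub (r := p - 1) (by linarith) (by linarith) ha.1.le hab hb.2.le
    rw [show p - 1 - 1 = p - 2 by ring] at h
    rw [hk]
    linarith
  have hx' : x ∈ Set.Icc (-w) w := abs_le.mp hx
  have hz' : z ∈ Set.Icc (-w) w := abs_le.mp hz
  have hmain : (sgnPow (p - 1) x - k * x) * (z - x) ≤ f z - f x := by
    rcases lt_trichotomy x z with h | h | h
    · have h1 := hconv.le_slope_of_hasDerivAt hx' hz' h (hderiv x)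
      rwa [slope_def_field, le_div_iff₀ (by linarith)] at h1
    · subst h; simp
    · have h1 := hconv.slope_le_of_hasDerivAt hz' hx' h (hderiv x)
      rw [slope_def_field, div_le_iff₀ (by linarith)] at h1
      linarith
  simp only [hf] at hmain
  rw [show (p - 1) / 2 * w ^ (p - 2) = k / 2 by rw [hk]; ring]
  nlinarith [hmain]

/-! ### Duality mappings and Bregman distances on ℓ^p -/

section Duality

variable {p : ℝ} [hp : Fact (1 < p)]

theorem Jp_apply (x z : ellp p) : Jp x z = ∑' i, sgnPow (p - 1) (x i) * z i := rfl

theorem norm_Jp_le (x : ellp p) : ‖Jp x‖ ≤ ‖x‖ ^ (p - 1) :=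
  LinearMap.mkContinuous_norm_le _ (Real.rpow_nonneg (norm_nonneg _) _) _

theorem Jp_self (x : ellp p) : Jp x x = ‖x‖ ^ p := by
  rw [Jp_apply, ← (hasSum_abs_rpow x).tsum_eq]
  exact tsum_congr fun i => sgnPow_mul_self (by linarith [hp.out]) _

theorem one_lt_conj : 1 < Real.conjExponent p := (holderConj (p := p)).symm.lt

theorem conj_sub_one_mul_sub_one : (Real.conjExponent p - 1) * (p - 1) = 1 := by
  have h1 : p - 1 ≠ 0 := by linarith [hp.out]
  rw [Real.conjExponent]; field_simp; ring

theorem coord_Jp (x : ellp p) (i : ℕ) : coord (Jp x) i = sgnPow (p - 1) (x i) := by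
  rw [coord, Jp_apply, tsum_eq_single i]
  · simp
  · intro j hj
    simp [hj]

/-- Every x is the norm limit of its truncations since p < ∞, and functionals are continuous. -/
theorem ext_coord {ξ η : StrongDual ℝ (ellp p)} (h : ∀ i, coord ξ i = coord η i) : ξ = η := by
  ext x
  have hs := lp.hasSum_single (p := ENNReal.ofReal p) ENNReal.ofReal_ne_top x
  have h1 := ξ.hasSum hs
  have h2 := η.hasSum hs
  have h3 : ∀ (ζ : StrongDual ℝ (ellp p)) (i : ℕ),
      ζ (lp.single (ENNReal.ofReal p) i (x i)) = x i * coord ζ i := fun ζ i => by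
    have : lp.single (E := fun _ : ℕ => ℝ) (ENNReal.ofReal p) i (x i)
        = x i • lp.single (ENNReal.ofReal p) i (1 : ℝ) := by
      rw [← lp.single_smul]; simp
    rw [this, map_smul, smul_eq_mul, coord]
  simp only [h3] at h1 h2
  simp only [h] at h1
  exact h1.unique h2

/-- Coordinatewise this is (p − 1)(q − 1) = 1. It makes a dual step an affine move of J_p x. -/
theorem Jp_Jq (ξ : StrongDual ℝ (ellp p)) : Jp (Jq ξ) = ξ := by
  refine ext_coord fun i => ?_
  rw [coord_Jp]
  exact sgnPow_sgnPow (by linarith [hp.out]) (by linarith [one_lt_conj (p := p)])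
    conj_sub_one_mul_sub_one _

/-- If `‖J_p x‖ ≤ R` then `‖x‖ ≤ R ^ (q - 1)`. -/
theorem norm_le_of_norm_Jp_le {x : ellp p} {R : ℝ} (h : ‖Jp x‖ ≤ R) :
    ‖x‖ ≤ R ^ (Real.conjExponent p - 1) := by
  have hR : 0 ≤ R := (norm_nonneg _).trans h
  have hq := one_lt_conj (p := p)
  rcases (norm_nonneg x).eq_or_lt with h0 | h0
  · rw [← h0]; exact Real.rpow_nonneg hR _
  have h1 : ‖x‖ ^ p ≤ R * ‖x‖ := by
    rw [← Jp_self]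
    exact (le_abs_self _).trans (((Jp x).le_opNorm x).trans
      (mul_le_mul_of_nonneg_right h h0.le))
  have h2 : ‖x‖ ^ p = ‖x‖ ^ (p - 1) * ‖x‖ := by
    rw [Real.rpow_sub_one h0.ne']; field_simp
  rw [h2] at h1
  have h3 : ‖x‖ ^ (p - 1) ≤ R := le_of_mul_le_mul_right h1 h0
  calc ‖x‖ = (‖x‖ ^ (p - 1)) ^ (Real.conjExponent p - 1) := by
        rw [← Real.rpow_mul h0.le, mul_comm, conj_sub_one_mul_sub_one, Real.rpow_one]
    _ ≤ _ := Real.rpow_le_rpow (Real.rpow_nonneg h0.le _) h3 (by linarith)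

/-- The Bregman distance splits over coordinates, so scalar convexity inequalities can be summed. -/
theorem hasSum_breg (z x : ellp p) :
    HasSum (fun i => 1 / p * |z i| ^ p - 1 / p * |x i| ^ p - sgnPow (p - 1) (x i) * (z i - x i))
      (breg z x) := by
  refine (((hasSum_abs_rpow z).mul_left (1 / p)).sub ((hasSum_abs_rpow x).mul_left (1 / p))).sub ?_
  have := (duality_bound x (z - x)).1.hasSum
  rw [Jp_apply]
  simpa using this

theorem breg_nonneg (hp2 : p ≤ 2) (z x : ellp p) : 0 ≤ breg z x := by
  refine (hasSum_breg z x).nonneg fun i => ?_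
  refine le_trans ?_ (scalar_breg_ge hp.out hp2 (le_max_left |x i| |z i|) (le_max_right _ _))
  have := hp.out
  have h0 : 0 ≤ max |x i| |z i| := (abs_nonneg _).trans (le_max_left _ _)
  have : 0 ≤ p - 1 := by linarith
  positivity

/-- Strong convexity of `f_p` on bounded sets. -/
theorem breg_ge (hp2 : p ≤ 2) {z x : ellp p} {N : ℝ} (hN : ‖z‖ + ‖z - x‖ ≤ N) :
    (p - 1) / 2 * N ^ (p - 2) * ‖z - x‖ ^ 2 ≤ breg z x := by
  have hp1 := hp.out
  have hp0 : 0 < p := by linarith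
  rcases (norm_nonneg (z - x)).eq_or_lt with h0 | h0
  · rw [← h0]; simpa using breg_nonneg hp2 z x
  set H := ‖z - x‖ with hH
  have hN0 : 0 < N := by linarith [norm_nonneg z]
  obtain ⟨W, hW0, hW, hsW⟩ := Real.Lp_add_le_hasSum_of_nonneg hp1.le
    (fun i => abs_nonneg (z i)) (fun i => abs_nonneg ((z - x) i)) (norm_nonneg z) h0.le
    (hasSum_abs_rpow z) (hasSum_abs_rpow (z - x))
  -- Chosen so that κ times the claimed lower bound equals p / 2; the sum over coordinates will give
  -- p / 2 ≤ κ * breg z x.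
  set κ := p / (p - 1) * N ^ (2 - p) / H ^ 2 with hκ
  have hp1' : 0 < p - 1 := by linarith
  have hκ0 : 0 < κ := by positivity
  have hpt : ∀ i, 1 / H ^ p * |(z - x) i| ^ p ≤
      κ * (1 / p * |z i| ^ p - 1 / p * |x i| ^ p - sgnPow (p - 1) (x i) * (z i - x i)) +
        (1 - p / 2) / N ^ p * (|z i| + |(z - x) i|) ^ p := fun i => by
    set w := |z i| + |(z - x) i| with hw
    have hsub : (z - x) i = z i - x i := by simp
    have hwz : |z i| ≤ w := by rw [hw]; linarith [abs_nonneg ((z - x) i)]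
    have hwx : |x i| ≤ w := by
      rw [hw, hsub]
      have := abs_sub_abs_le_abs_sub (x i) (z i)
      rw [abs_sub_comm] at this
      linarith
    have hw0 : 0 ≤ w := (abs_nonneg _).trans hwz
    have hs := scalar_breg_ge hp1 hp2 hwx hwz
    set B := 1 / p * |z i| ^ p - 1 / p * |x i| ^ p - sgnPow (p - 1) (x i) * (z i - x i)
    have hB : (p / 2) * (w ^ (p - 2) * |z i - x i| ^ 2 * N ^ (2 - p) / H ^ 2) ≤ κ * B := by
      refine le_trans (le_of_eq ?_) (mul_le_mul_of_nonneg_left hs hκ0.le)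
      rw [hκ, sq_abs]; field_simp
    refine le_trans ?_ (add_le_add_left hB _)
    rcases hw0.eq_or_lt with h1 | h1
    · have : (z - x) i = 0 := by
        have := abs_nonneg (z i); have h3 := abs_nonneg ((z - x) i)
        exact abs_eq_zero.mp (by linarith)
      rw [this, abs_zero, Real.zero_rpow hp0.ne', mul_zero]
      have : 0 ≤ 1 - p / 2 := by linarith
      positivity
    -- Young's inequality in place of a reverse Hölder inequality: |h|^p / H^p, with h = z i - x i,
    -- is the geometric mean with weights p/2 and 1 − p/2 of the strong convexity term and of w^p /
    -- N^p. By Minkowski the latter sums to at most 1.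
    have ham := Real.geom_mean_le_arith_mean2_weighted (w₁ := p / 2) (w₂ := 1 - p / 2)
      (p₁ := w ^ (p - 2) * |z i - x i| ^ 2 * N ^ (2 - p) / H ^ 2) (p₂ := w ^ p / N ^ p)
      (by positivity) (by linarith) (by positivity) (by positivity) (by ring)
    refine le_trans (le_of_eq ?_) (ham.trans (le_of_eq (by ring)))
    rw [hsub]
    have hsq : ∀ a : ℝ, 0 ≤ a → (a ^ 2) ^ (p / 2) = a ^ p := fun a ha => by
      rw [← Real.rpow_natCast, ← Real.rpow_mul ha]; congr 1; push_cast; ring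
    rw [Real.div_rpow (by positivity) (by positivity), Real.mul_rpow (by positivity) (by positivity),
      Real.mul_rpow (by positivity) (by positivity), Real.div_rpow (by positivity) (by positivity),
      hsq _ (abs_nonneg _), hsq _ h0.le, ← Real.rpow_mul h1.le, ← Real.rpow_mul hN0.le,
      ← Real.rpow_mul h1.le, ← Real.rpow_mul hN0.le]
    have e1 : w ^ (p * (2 - p) / 2) * w ^ (p * (p - 2) / 2) = 1 := by
      rw [← Real.rpow_add h1, show p * (2 - p) / 2 + p * (p - 2) / 2 = 0 by ring, Real.rpow_zero]
    rw [show (2 - p) * (p / 2) = p * (1 - p / 2) by ring]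
    have : N ^ (p * (1 - p / 2)) ≠ 0 := (Real.rpow_pos_of_pos hN0 _).ne'
    have hHp : H ^ p ≠ 0 := (Real.rpow_pos_of_pos h0 _).ne'
    field_simp
    linear_combination (-|z i - x i| ^ p) * e1
  have hsum := hasSum_le hpt ((hasSum_abs_rpow (z - x)).mul_left (1 / H ^ p))
    (((hasSum_breg z x).mul_left κ).add (hsW.mul_left ((1 - p / 2) / N ^ p)))
  have hHp : 0 < H ^ p := Real.rpow_pos_of_pos h0 _
  have hNp : 0 < N ^ p := Real.rpow_pos_of_pos hN0 _
  have hWN : W ^ p ≤ N ^ p := Real.rpow_le_rpow hW0 (hW.trans hN) hp0.le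
  have h2 : (1 - p / 2) / N ^ p * W ^ p ≤ 1 - p / 2 := by
    rw [div_mul_eq_mul_div, div_le_iff₀ hNp]
    exact mul_le_mul_of_nonneg_left hWN (by linarith)
  rw [← hH, one_div_mul_cancel hHp.ne'] at hsum
  have h3 : p / 2 ≤ κ * breg z x := by linarith
  have h4 : κ * ((p - 1) / 2 * N ^ (p - 2) * H ^ 2) = p / 2 := by
    have : N ^ (2 - p) * N ^ (p - 2) = 1 := by
      rw [← Real.rpow_add hN0, show 2 - p + (p - 2) = 0 by ring, Real.rpow_zero]
    rw [hκ]; field_simp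
    linear_combination this
  exact le_of_mul_le_mul_left (h4.trans_le h3) hκ0

theorem breg_add_breg (z x : ellp p) : breg z x + breg x z = (Jp z - Jp x) (z - x) := by
  simp only [breg, map_sub, sub_apply]; ring

/-- The three point identity. -/
theorem breg_three_point (u z x : ellp p) :
    breg u z = breg u x - breg z x - (Jp z - Jp x) (u - z) := by
  simp only [breg, map_sub, sub_apply]; ring

/-- A smoothness bound `D(z, x) ≤ C ‖x - z‖ ^ p` gives an upper bound for the distance of
gradients. -/
theorem norm_Jp_sub_mul_le {C : ℝ} (hC : ∀ x z : ellp p, breg z x ≤ C * ‖x - z‖ ^ p) (hp2 : p ≤ 2)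
    (x z : ellp p) {l : ℝ} (hl : 0 < l) : ‖Jp z - Jp x‖ * l ≤ breg x z + C * l ^ p := by
  -- The sign of C comes from testing the smoothness bound on a vector of norm l.
  have hC0 : 0 ≤ C * l ^ p := by
    have := (breg_nonneg hp2 (lp.single (ENNReal.ofReal p) 0 l : ellp p) 0).trans (hC _ _)
    have hl' : ‖(lp.single (ENNReal.ofReal p) 0 l : ellp p)‖ = l := by
      rw [lp.norm_single (by simpa using lt_trans zero_lt_one hp.out)]
      simp [abs_of_pos hl]
    rwa [zero_sub, norm_neg, hl'] at this
  have hb := breg_nonneg hp2 x z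
  rw [← le_div_iff₀ hl]
  refine ContinuousLinearMap.opNorm_le_bound _ (by positivity) fun v => ?_
  have key : ∀ v : ellp p, (Jp z - Jp x) v ≤ (breg x z + C * l ^ p) / l * ‖v‖ := fun v => by
    rcases (norm_nonneg v).eq_or_lt with h0 | h0
    · have : v = 0 := norm_eq_zero.mp h0.symm
      simp [this]
    set u : ellp p := (l / ‖v‖) • v with hu
    have hun : ‖u‖ = l := by
      rw [hu, norm_smul, Real.norm_of_nonneg (by positivity)]; field_simp
    have h1 := breg_nonneg hp2 (x + u) z
    have h2 := hC x (x + u)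
    rw [show x - (x + u) = -u by abel, norm_neg, hun] at h2
    -- Shift x by a vector of length l: D(x + u, z) ≥ 0 is dropped and D(x + u, x) is bounded by
    -- smoothness.
    have h3 : (Jp z - Jp x) u ≤ breg x z + C * l ^ p := by
      have : (Jp z - Jp x) u = breg x z + breg (x + u) x - breg (x + u) z := by
        simp only [breg, map_sub, map_add, sub_apply]; ring
      linarith
    rw [hu, map_smul, smul_eq_mul] at h3
    rw [div_mul_eq_mul_div, le_div_iff₀ hl]
    have h4 : l / ‖v‖ * (Jp z - Jp x) v * ‖v‖ = (Jp z - Jp x) v * l := by field_simp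
    rw [← h4]
    exact mul_le_mul_of_nonneg_right h3 h0.le
  rw [Real.norm_eq_abs, abs_le]
  have h1 := key v
  have h2 := key (-v)
  rw [map_neg, norm_neg] at h2
  exact ⟨by linarith, h1⟩

theorem smoothness_const_pos {C : ℝ} (hC : ∀ x z : ellp p, breg z x ≤ C * ‖x - z‖ ^ p) :
    0 < C := by
  have hp0 : 0 < p := by linarith [hp.out]
  set e : ellp p := lp.single (ENNReal.ofReal p) 0 (1 : ℝ)
  have h1 : ‖e‖ = 1 := by
    rw [lp.norm_single (by simpa using hp0)]; simp
  have h := hC 0 e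
  have h2 : breg e 0 = 1 / p := by
    have : Jp (0 : ellp p) = 0 := by
      ext v; simp [Jp_apply, sgnPow_zero]
    simp [breg, fp, this, h1, Real.zero_rpow hp0.ne']
  rw [h2, zero_sub, norm_neg, h1, Real.one_rpow, mul_one] at h
  exact lt_of_lt_of_le (by positivity) h

/-- The first order remainder is D(x + h, x), which is O(‖h‖^p) and hence o(‖h‖) as p > 1. -/
theorem hasFDerivAt_fp {C : ℝ} (hC : ∀ x z : ellp p, breg z x ≤ C * ‖x - z‖ ^ p) (hp2 : p ≤ 2)
    (x : ellp p) : HasFDerivAt fp (Jp x) x := by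
  have hp1 := hp.out
  rw [hasFDerivAt_iff_isLittleO_nhds_zero]
  have h1 : (fun h : ellp p => fp (x + h) - fp x - Jp x h) =O[nhds 0] fun h => ‖h‖ ^ p := by
    refine Asymptotics.IsBigO.of_bound C (Filter.Eventually.of_forall fun h => ?_)
    have e : fp (x + h) - fp x - Jp x h = breg (x + h) x := by simp [breg]
    rw [e, Real.norm_of_nonneg (breg_nonneg hp2 _ _),
      Real.norm_of_nonneg (Real.rpow_nonneg (norm_nonneg _) _)]
    have := hC x (x + h)
    rwa [show x - (x + h) = -h by abel, norm_neg] at this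
  refine h1.trans_isLittleO ?_
  rw [Asymptotics.isLittleO_iff]
  intro ε hε
  have hc : Filter.Tendsto (fun h : ellp p => ‖h‖ ^ (p - 1)) (nhds 0) (nhds 0) := by
    have : ContinuousAt (fun h : ellp p => ‖h‖ ^ (p - 1)) 0 :=
      continuous_norm.continuousAt.rpow_const (Or.inr (by linarith))
    simpa [ContinuousAt, Real.zero_rpow (show p - 1 ≠ 0 by linarith)] using this
  filter_upwards [hc.eventually (gt_mem_nhds hε)] with h hh
  rw [Real.norm_of_nonneg (Real.rpow_nonneg (norm_nonneg _) _)]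
  rcases (norm_nonneg h).eq_or_lt with h0 | h0
  · rw [← h0, Real.zero_rpow (by linarith), mul_zero]
  · have : ‖h‖ ^ p = ‖h‖ ^ (p - 1) * ‖h‖ := by rw [Real.rpow_sub_one h0.ne']; field_simp
    rw [this]
    exact mul_le_mul_of_nonneg_right hh.le h0.le

end Duality

end TIGRA

/-! ### The Tikhonov functional and its minimizers -/

namespace TIGRA

namespace Problem

variable {p : ℝ} [hp : Fact (1 < p)] {Y : Type*} [NormedAddCommGroup Y] [InnerProductSpace ℝ Y]
  {P : Problem p Y} {y : Y}

theorem Phi_nonneg (P : Problem p Y) {α : ℝ} (hα : 0 ≤ α) (x : ellp p) : 0 ≤ P.Phi α x := by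
  have := hp.out
  unfold Phi fp
  positivity

theorem gradPhi_apply (P : Problem p Y) (α : ℝ) (x v : ellp p) :
    P.gradPhi α x v =
      Inner.inner ℝ (P.F x - P.ydelta) (fderiv ℝ P.F x v) + α * Jp x v := rfl

/-- The first order expansion of `Φ_α` with its remainder. -/
theorem Phi_expand (P : Problem p Y) (α : ℝ) (z x : ellp p) :
    P.Phi α z = P.Phi α x + P.gradPhi α x (z - x) + 1 / 2 * ‖P.F z - P.F x‖ ^ 2 +
      Inner.inner ℝ (P.F x - P.ydelta) (P.F z - P.F x - fderiv ℝ P.F x (z - x)) +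
      α * breg z x := by
  have h : P.F z - P.ydelta = (P.F x - P.ydelta) + (P.F z - P.F x) := by abel
  rw [Phi, Phi, gradPhi_apply, h, norm_add_sq_real,
    inner_sub_right _ (P.F z - P.F x), breg]
  ring

theorem Assumption.abs_inner_remainder_le (hA : P.Assumption y) (x z : ellp p) (v : Y) :
    |Inner.inner ℝ v (P.F z - P.F x - fderiv ℝ P.F x (z - x))| ≤ ‖v‖ * (P.c * breg z x) :=
  (abs_real_inner_le_norm _ _).trans
    (mul_le_mul_of_nonneg_left (hA.nonlinearity z x) (norm_nonneg _))

theorem Assumption.s_pos (hA : P.Assumption y) : 0 < P.s := by linarith [hA.s_gt]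

theorem Assumption.alphaStar_pos (hA : P.Assumption y) (hδ : 0 < P.delta) : 0 < P.alphaStar :=
  div_pos hδ (mul_pos (by linarith [hA.s_gt]) hA.rho_pos)

theorem Assumption.scrho_lt (hA : P.Assumption y) : P.s * P.c * P.rho < 1 := by
  have h := hA.rho_lt
  rw [lt_div_iff₀ (mul_pos hA.s_pos hA.c_pos)] at h
  linarith

theorem Assumption.gam_pos (hA : P.Assumption y) : 0 < P.gam := by
  have := hA.scrho_lt
  unfold gam; linarith

theorem Assumption.delta_le (hA : P.Assumption y) {α : ℝ} (hα : P.alphaStar ≤ α) :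
    P.delta ≤ (P.s - 2) * P.rho * α := by
  have h : 0 < (P.s - 2) * P.rho := mul_pos (by linarith [hA.s_gt]) hA.rho_pos
  rw [alphaStar, div_le_iff₀ h] at hα
  linarith

theorem Assumption.A_nonneg (hA : P.Assumption y) (hδ : 0 < P.delta) : 0 ≤ P.A := by
  have := hA.alphaStar_pos hδ
  have := hp.out
  unfold A
  positivity

theorem Assumption.norm_fderiv_le (hA : P.Assumption y) (x z : ellp p) :
    ‖fderiv ℝ P.F x‖ ≤ ‖fderiv ℝ P.F z‖ + P.L * ‖x - z‖ := by
  have h := hA.lipschitz x z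
  have := norm_le_norm_add_norm_sub' (fderiv ℝ P.F x) (fderiv ℝ P.F z)
  linarith

theorem Assumption.norm_fderiv_le_K (hA : P.Assumption y) {u : ellp p} (hu : ‖u‖ ≤ P.A) :
    ‖fderiv ℝ P.F u‖ ≤ P.K := by
  have h := hA.norm_fderiv_le u 0
  rw [sub_zero] at h
  have := mul_le_mul_of_nonneg_left hu hA.L_pos.le
  rw [K]; linarith

theorem Assumption.norm_fderiv_le_near (hA : P.Assumption y) {u x : ellp p} {R : ℝ}
    (hu : ‖u‖ ≤ P.A) (hx : ‖x - u‖ ≤ R) : ‖fderiv ℝ P.F x‖ ≤ P.L * R + P.K := by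
  have h := hA.norm_fderiv_le x u
  have h2 := hA.norm_fderiv_le_K hu
  have := mul_le_mul_of_nonneg_left hx hA.L_pos.le
  linarith

theorem Assumption.norm_F_sub_le (hA : P.Assumption y) {u x : ellp p} {R : ℝ}
    (hu : ‖u‖ ≤ P.A) (hx : ‖x - u‖ ≤ R) :
    ‖P.F x - P.F u‖ ≤ (P.L * R + P.K) * ‖x - u‖ := by
  refine Convex.norm_image_sub_le_of_norm_fderiv_le (𝕜 := ℝ) (s := Metric.closedBall u R)
    (fun z _ => hA.differentiable z) (fun z hz => hA.norm_fderiv_le_near hu ?_)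
    (convex_closedBall u R) ?_ ?_
  · rwa [← dist_eq_norm]
  · exact Metric.mem_closedBall_self ((norm_nonneg _).trans hx)
  · rwa [Metric.mem_closedBall, dist_eq_norm]

/-- The minimizers are bounded by `A`. -/
theorem Assumption.norm_minimizer_le (hA : P.Assumption y) (hδ : 0 < P.delta) {α : ℝ}
    (hα : P.alphaStar ≤ α) {u : ellp p} (hu : ∀ x, P.Phi α u ≤ P.Phi α x) : ‖u‖ ≤ P.A := by
  have hp0 : 0 < p := by linarith [hp.out]
  have hs := hA.alphaStar_pos hδ
  -- The competitor 0 has no penalty; the resulting bound on ‖u‖ is exactly A.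
  have h := hu 0
  simp only [Phi, fp, norm_zero, Real.zero_rpow hp0.ne', mul_zero, add_zero] at h
  have h1 : α * (1 / p * ‖u‖ ^ p) ≤ 1 / 2 * ‖P.F 0 - P.ydelta‖ ^ 2 := by
    nlinarith [sq_nonneg ‖P.F u - P.ydelta‖]
  have h0 : 0 ≤ ‖u‖ ^ p := Real.rpow_nonneg (norm_nonneg _) _
  have h2 : ‖u‖ ^ p ≤ p / (2 * P.alphaStar) * ‖P.F 0 - P.ydelta‖ ^ 2 := by
    have h3 : P.alphaStar * (1 / p * ‖u‖ ^ p) ≤ α * (1 / p * ‖u‖ ^ p) :=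
      mul_le_mul_of_nonneg_right hα (by positivity)
    have h4 := h3.trans h1
    have h5 : p / P.alphaStar * (P.alphaStar * (1 / p * ‖u‖ ^ p)) = ‖u‖ ^ p := by field_simp
    rw [← h5]
    refine (mul_le_mul_of_nonneg_left h4 (by positivity)).trans (le_of_eq ?_)
    field_simp
  calc ‖u‖ = (‖u‖ ^ p) ^ (1 / p) := by
        rw [← Real.rpow_mul (norm_nonneg _), mul_one_div_cancel hp0.ne', Real.rpow_one]
    _ ≤ (p / (2 * P.alphaStar) * ‖P.F 0 - P.ydelta‖ ^ 2) ^ (1 / p) :=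
        Real.rpow_le_rpow h0 h2 (by positivity)
    _ = P.A := by
        rw [A, Real.mul_rpow (by positivity) (by positivity), ← Real.rpow_natCast,
          ← Real.rpow_mul (norm_nonneg _)]
        congr 2
        push_cast; ring

/-- The residual of a minimizer under the source condition. -/
theorem Assumption.residual_le (hA : P.Assumption y) (hp2 : p ≤ 2) (hδ : 0 < P.delta)
    (hy : ‖y - P.ydelta‖ ≤ P.delta) {α : ℝ} (hα : P.alphaStar ≤ α) {u : ellp p}
    (hu : ∀ x, P.Phi α u ≤ P.Phi α x) : ‖P.F u - P.ydelta‖ ≤ P.delta + 2 * (P.rho * α) := by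
  have hα0 : 0 < α := (hA.alphaStar_pos hδ).trans_le hα
  obtain ⟨xd, ω, hF, -, hω, hJ⟩ := hA.source
  have h := hu xd
  set D := breg u xd with hD
  have hD0 : 0 ≤ D := breg_nonneg hp2 _ _
  have e1 : fp u - fp xd = D + Jp xd (u - xd) := by rw [hD, breg]; ring
  have e2 : Jp xd (u - xd) = Inner.inner ℝ ω (fderiv ℝ P.F xd (u - xd)) := by rw [hJ]; rfl
  set R := ‖P.F u - P.ydelta‖ with hR
  have hR0 : 0 ≤ R := norm_nonneg _
  have e3 : ‖fderiv ℝ P.F xd (u - xd)‖ ≤ R + P.delta + P.c * D := by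
    have : fderiv ℝ P.F xd (u - xd) = (P.F u - P.ydelta) - (y - P.ydelta) -
        (P.F u - P.F xd - fderiv ℝ P.F xd (u - xd)) := by rw [hF]; abel
    rw [this]
    refine (norm_sub_le _ _).trans (add_le_add ((norm_sub_le _ _).trans (by linarith)) ?_)
    exact hA.nonlinearity u xd
  have e4 : -(P.rho * (R + P.delta + P.c * D)) ≤ Jp xd (u - xd) := by
    rw [e2]
    refine (neg_le_neg ?_).trans (neg_le_of_abs_le (abs_real_inner_le_norm _ _))
    exact mul_le_mul hω e3 (norm_nonneg _) hA.rho_pos.le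
  have e5 : ‖P.F xd - P.ydelta‖ ^ 2 ≤ P.delta ^ 2 := by
    rw [hF]; exact pow_le_pow_left₀ (norm_nonneg _) hy 2
  simp only [Phi] at h
  -- Lets the Bregman distance absorb the remainder term ϱ c D from the source condition.
  have e6 : P.rho * P.c ≤ 1 := by
    have := hA.scrho_lt
    have := mul_pos hA.rho_pos hA.c_pos
    nlinarith [hA.s_gt]
  have e7 : 0 ≤ D * (1 - P.rho * P.c) := mul_nonneg hD0 (by linarith)
  have e8 : α * (fp u - fp xd) ≥ -(α * P.rho * (R + P.delta)) := by
    rw [e1]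
    have : -(P.rho * (R + P.delta)) ≤ D + Jp xd (u - xd) := by nlinarith
    nlinarith [mul_le_mul_of_nonneg_left this hα0.le]
  -- Complete the square in R² − 2αϱ(R + δ) ≤ δ².
  have e9 : (R - P.rho * α) ^ 2 ≤ (P.delta + P.rho * α) ^ 2 := by nlinarith
  have := abs_le_of_sq_le_sq' e9 (by have := mul_pos hA.rho_pos hα0; linarith)
  linarith [this.2]

/-- The threshold α ≥ α_* says precisely δ ≤ (s − 2)ϱα. -/
theorem Assumption.residual_le' (hA : P.Assumption y) (hp2 : p ≤ 2) (hδ : 0 < P.delta)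
    (hy : ‖y - P.ydelta‖ ≤ P.delta) {α : ℝ} (hα : P.alphaStar ≤ α) {u : ellp p}
    (hu : ∀ x, P.Phi α u ≤ P.Phi α x) : ‖P.F u - P.ydelta‖ ≤ P.s * P.rho * α := by
  have := hA.residual_le hp2 hδ hy hα hu
  have := hA.delta_le hα
  linarith

/-- The first order optimality condition. -/
theorem Assumption.gradPhi_eq_zero (hA : P.Assumption y) (hp2 : p ≤ 2)
    (hcpt : ∀ x z : ellp p, breg z x ≤ P.cpt * ‖x - z‖ ^ p) {α : ℝ} {u : ellp p}
    (hu : ∀ x, P.Phi α u ≤ P.Phi α x) : P.gradPhi α u = 0 := by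
  have h1 : HasFDerivAt (fun x => P.F x - P.ydelta) (fderiv ℝ P.F u) u :=
    (hA.differentiable u).hasFDerivAt.sub_const _
  have h2 := (h1.norm_sq.const_mul (1 / 2)).add ((hasFDerivAt_fp hcpt hp2 u).const_mul α)
  have hmin : IsLocalMin (P.Phi α) u := Filter.Eventually.of_forall hu
  have h3 := hmin.hasFDerivAt_eq_zero (f' := _) h2
  rw [← h3, gradPhi]
  congr 1
  ext v
  simp

/-- Directional convexity of `Φ_α` towards the minimizer, with a Bregman distance gain. -/
theorem Assumption.le_gradPhi_apply (hA : P.Assumption y) (hp2 : p ≤ 2) {α : ℝ} {u x : ellp p}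
    (hres : ‖P.F u - P.ydelta‖ ≤ P.s * P.rho * α) (hF : P.c * ‖P.F x - P.F u‖ ≤ P.gam * α) :
    P.Phi α x - P.Phi α u + P.gam * α * breg u x ≤ P.gradPhi α x (x - u) := by
  have h := P.Phi_expand α u x
  have h1 := neg_le_of_abs_le (hA.abs_inner_remainder_le x u (P.F x - P.ydelta))
  have hD := breg_nonneg hp2 u x
  have h2 : ‖P.F x - P.ydelta‖ ≤ ‖P.F x - P.F u‖ + P.s * P.rho * α := by
    have : P.F x - P.ydelta = (P.F x - P.F u) + (P.F u - P.ydelta) := by abel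
    rw [this]
    exact (norm_add_le _ _).trans (by linarith)
  have h3 : P.c * ‖P.F x - P.ydelta‖ ≤ P.gam * α + P.s * P.c * P.rho * α := by
    nlinarith [hA.c_pos]
  have h4 := mul_le_mul_of_nonneg_right h3 hD
  have h5 : P.gradPhi α x (u - x) = -P.gradPhi α x (x - u) := by
    rw [← map_neg, neg_sub]
  -- Of the weight α of D(u, x), the remainder consumes γα + scϱα; by the definition of γ, γα is
  -- left over.
  have h6 : α = 2 * P.gam * α + P.s * P.c * P.rho * α := by rw [gam]; ring
  have h7 : α * breg u x = 2 * P.gam * α * breg u x + P.s * P.c * P.rho * α * breg u x := by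
    rw [← add_mul, ← h6]
  rw [h5] at h
  nlinarith [sq_nonneg ‖P.F u - P.F x‖]

theorem Assumption.r_pos (hA : P.Assumption y) (hK : 0 < P.K) {α : ℝ} (hα : 0 < α) :
    0 < P.r α := by
  have := hA.gam_pos
  have := hA.c_pos
  have := hA.L_pos
  have := hA.s_pos
  unfold r
  positivity

theorem Assumption.r_mono (hA : P.Assumption y) (hK : 0 < P.K) {α α' : ℝ} (h : α ≤ α') :
    P.r α ≤ P.r α' := by
  have := hA.gam_pos
  have := hA.c_pos
  have := hA.L_pos
  have := hA.s_pos
  unfold r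
  gcongr

/-- The radius is small enough for directional convexity. With 2/(1 + √2) ≤ 0.84 and s > 2 the two
summands are at most 0.42 γα and 0.1 γα. -/
theorem Assumption.c_mul_r_le (hA : P.Assumption y) (hK : 0 < P.K) {α : ℝ} (hα : 0 < α) :
    P.c * ((P.L * P.r α + P.K) * P.r α) ≤ P.gam * α := by
  have hg := hA.gam_pos
  have hc := hA.c_pos
  have hL := hA.L_pos
  have hs := hA.s_pos
  have hr := hA.r_pos hK hα
  have hgα : 0 < P.gam * α := by positivity
  have h2 : (1.4 : ℝ) ≤ √2 := by
    rw [Real.le_sqrt (by norm_num) (by norm_num)]; norm_num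
  have h3 : 2 / (1 + √2) ≤ 0.84 := by
    rw [div_le_iff₀ (by positivity)]; linarith
  have hm1 : 0 ≤ P.gam * α / (P.c * P.s * P.K) := by positivity
  have hm2 : 0 ≤ √(P.gam * α / (10 * P.c * P.L)) := Real.sqrt_nonneg _
  have hr1 : P.r α ≤ 0.84 * (P.gam * α / (P.c * P.s * P.K)) :=
    mul_le_mul h3 (min_le_left _ _) (le_min hm1 hm2) (by norm_num)
  have hr2 : P.r α ≤ 0.84 * √(P.gam * α / (10 * P.c * P.L)) :=
    mul_le_mul h3 (min_le_right _ _) (le_min hm1 hm2) (by norm_num)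
  have a1 : P.c * P.K * P.r α ≤ 0.42 * (P.gam * α) := by
    have : P.s * (P.c * P.K * P.r α) ≤ 0.84 * (P.gam * α) := by
      refine (le_of_eq ?_).trans ((mul_le_mul_of_nonneg_left hr1
        (show 0 ≤ P.c * P.s * P.K by positivity)).trans (le_of_eq ?_))
      · ring
      · field_simp
    have h4 : 0 ≤ P.c * P.K * P.r α := by positivity
    nlinarith [hA.s_gt]
  have a2 : P.c * P.L * P.r α ^ 2 ≤ 0.1 * (P.gam * α) := by
    have h5 : P.r α ^ 2 ≤ P.gam * α / (10 * P.c * P.L) := by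
      have h6 := pow_le_pow_left₀ hr.le hr2 2
      rw [mul_pow, Real.sq_sqrt (by positivity)] at h6
      have h7 : 0 ≤ P.gam * α / (10 * P.c * P.L) := by positivity
      nlinarith
    refine (mul_le_mul_of_nonneg_left h5 (show 0 ≤ P.c * P.L by positivity)).trans (le_of_eq ?_)
    field_simp
    norm_num
  nlinarith

theorem Assumption.cAbar_pos (hA : P.Assumption y) (hK : 0 < P.K) (hδ : 0 < P.delta) {α : ℝ}
    (hα : 0 < α) : 0 < P.cAbar α := by
  have h1 := hA.r_pos hK hα
  have h2 := hA.A_nonneg hδ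
  have h3 : 0 < p - 1 := by linarith [hp.out]
  unfold cAbar
  positivity

end Problem

end TIGRA

/-! ### One level: invariance of the region and finiteness of the inner iteration -/

namespace TIGRA

namespace Problem

variable {p : ℝ} [hp : Fact (1 < p)] {Y : Type*} [NormedAddCommGroup Y] [InnerProductSpace ℝ Y]
  {P : Problem p Y} {y : Y}

/-- The setting of one inner iteration: `u` is a minimizer of `Φ_α` whose Bregman ball of radius
`dα` lies in the norm ball of radius `r_α`, and `C`, `M` are admissible. -/
structure Level (P : Problem p Y) (y : Y) (α dα C M : ℝ) (u : ellp p) : Prop where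
  le_two : p ≤ 2
  delta_pos : 0 < P.delta
  smooth : ∀ x z : ellp p, breg z x ≤ P.cpt * ‖x - z‖ ^ p
  assumption : P.Assumption y
  K_pos : 0 < P.K
  alpha_pos : 0 < α
  d_pos : 0 < dα
  C_pos : 0 < C
  M_ge : P.Mmin α dα C ≤ M
  minimizer : ∀ x, P.Phi α u ≤ P.Phi α x
  norm_le : ‖u‖ ≤ P.A
  residual : ‖P.F u - P.ydelta‖ ≤ P.s * P.rho * α
  ball : ∀ x, breg u x ≤ dα → ‖x - u‖ ≤ P.r α

theorem Jp_dualStep (P : Problem p Y) (α t : ℝ) (x : ellp p) :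
    Jp (P.dualStep α t x) = Jp x - t • P.gradPhi α x := Jp_Jq _

namespace Level

variable {α dα C M : ℝ} {u : ellp p}

theorem r_pos (h : P.Level y α dα C M u) : 0 < P.r α := h.assumption.r_pos h.K_pos h.alpha_pos

theorem cAbar_pos (h : P.Level y α dα C M u) : 0 < P.cAbar α :=
  h.assumption.cAbar_pos h.K_pos h.delta_pos h.alpha_pos

theorem gam_mul_pos (h : P.Level y α dα C M u) : 0 < P.gam * α :=
  mul_pos h.assumption.gam_pos h.alpha_pos

theorem lip_pos (h : P.Level y α dα C M u) : 0 < P.L * P.r α + P.K :=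
  add_pos (mul_pos h.assumption.L_pos h.r_pos) h.K_pos

theorem T_pos (h : P.Level y α dα C M u) : 0 < P.T α C :=
  div_pos h.r_pos (mul_pos (lt_of_lt_of_le one_pos (le_max_left _ _)) h.C_pos)

theorem residual_bound_pos (h : P.Level y α dα C M u) :
    0 < P.c * dα + (P.L * P.r α + P.K) * P.r α + P.s * P.rho * α := by
  have := h.assumption.c_pos
  have := h.assumption.s_pos
  have := h.assumption.rho_pos
  have := h.lip_pos
  have := h.r_pos
  have := h.d_pos
  have := h.alpha_pos
  positivity

theorem r_add_A_pos (h : P.Level y α dα C M u) : 0 < P.r α + P.A :=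
  add_pos_of_pos_of_nonneg h.r_pos (h.assumption.A_nonneg h.delta_pos)

theorem kappa_pos (h : P.Level y α dα C M u) : 0 < P.kappa α dα := by
  have := h.residual_bound_pos
  have := h.lip_pos
  have := h.r_add_A_pos
  have := h.alpha_pos
  unfold kappa
  positivity

theorem cpAlpha_pos (h : P.Level y α dα C M u) : 0 < P.cpAlpha α dα C := by
  have := h.r_add_A_pos
  have := h.T_pos
  have := h.kappa_pos
  have : 0 < p - 1 := by linarith [hp.out]
  unfold cpAlpha
  positivity

theorem M_ge_relSmooth (h : P.Level y α dα C M u) :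
    P.c ^ 2 * P.T α C ^ 2 * P.kappa α dα ^ 2 / (2 * P.cpAlpha α dα C) +
      (P.L * P.r α + P.K) ^ 2 / P.cpAlpha α dα C +
      P.c * (P.c * dα + (P.L * P.r α + P.K) * P.r α + P.s * P.rho * α) + α ≤ M :=
  (le_max_right _ _).trans h.M_ge

theorem M_pos (h : P.Level y α dα C M u) : 0 < M := by
  have := h.M_ge_relSmooth
  have := h.cpAlpha_pos
  have := h.residual_bound_pos
  have := h.assumption.c_pos
  have h1 : 0 ≤ P.c ^ 2 * P.T α C ^ 2 * P.kappa α dα ^ 2 / (2 * P.cpAlpha α dα C) +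
      (P.L * P.r α + P.K) ^ 2 / P.cpAlpha α dα C +
      P.c * (P.c * dα + (P.L * P.r α + P.K) * P.r α + P.s * P.rho * α) := by positivity
  linarith [h.alpha_pos]

/-- The first entry of the maximum in `Mmin` caps the steps by T, so one convexity constant serves
all of them. -/
theorem inv_two_M_le_T (h : P.Level y α dα C M u) : 1 / (2 * M) ≤ P.T α C := by
  have h1 : 1 / (2 * P.T α C) ≤ M := (le_max_left _ _).trans h.M_ge
  have hT := h.T_pos
  have hM := h.M_pos
  rw [div_le_iff₀ (by positivity)] at h1 ⊢
  linarith

variable {x : ellp p}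

theorem norm_fderiv_le (h : P.Level y α dα C M u) (hx : breg u x ≤ dα) :
    ‖fderiv ℝ P.F x‖ ≤ P.L * P.r α + P.K :=
  h.assumption.norm_fderiv_le_near h.norm_le (h.ball x hx)

theorem norm_F_sub_le (h : P.Level y α dα C M u) (hx : breg u x ≤ dα) :
    ‖P.F x - P.F u‖ ≤ (P.L * P.r α + P.K) * ‖x - u‖ :=
  h.assumption.norm_F_sub_le h.norm_le (h.ball x hx)

theorem norm_residual_le (h : P.Level y α dα C M u) (hx : breg u x ≤ dα) :
    ‖P.F x - P.ydelta‖ ≤ P.c * dα + (P.L * P.r α + P.K) * P.r α + P.s * P.rho * α := by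
  have h1 := h.norm_F_sub_le hx
  have h2 := mul_le_mul_of_nonneg_left (h.ball x hx) h.lip_pos.le
  have h3 := h.residual
  have h4 := mul_pos h.assumption.c_pos h.d_pos
  have h5 : P.F x - P.ydelta = (P.F x - P.F u) + (P.F u - P.ydelta) := by abel
  rw [h5]
  exact (norm_add_le _ _).trans (by linarith)

theorem norm_le_of_mem (h : P.Level y α dα C M u) (hx : breg u x ≤ dα) : ‖x‖ ≤ P.r α + P.A := by
  have h1 := norm_le_norm_add_norm_sub' x u
  linarith [h.ball x hx, h.norm_le]

theorem norm_Jp_le_of_mem (h : P.Level y α dα C M u) (hx : breg u x ≤ dα) :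
    ‖Jp x‖ ≤ (P.r α + P.A) ^ (p - 1) :=
  (norm_Jp_le x).trans
    (Real.rpow_le_rpow (norm_nonneg _) (h.norm_le_of_mem hx) (by linarith [hp.out]))

theorem norm_gradPhi_le (h : P.Level y α dα C M u) (hx : breg u x ≤ dα) :
    ‖P.gradPhi α x‖ ≤ P.kappa α dα := by
  refine (norm_add_le _ _).trans (add_le_add ?_ ?_)
  · refine (ContinuousLinearMap.opNorm_comp_le _ _).trans ?_
    rw [innerSL_apply_norm, mul_comm]
    exact mul_le_mul (h.norm_fderiv_le hx) (h.norm_residual_le hx) (norm_nonneg _) h.lip_pos.le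
  · rw [norm_smul, Real.norm_of_nonneg h.alpha_pos.le]
    exact mul_le_mul_of_nonneg_left (h.norm_Jp_le_of_mem hx) h.alpha_pos.le

theorem le_gradPhi_apply (h : P.Level y α dα C M u) (hx : breg u x ≤ dα) :
    P.Phi α x - P.Phi α u + P.gam * α * breg u x ≤ P.gradPhi α x (x - u) := by
  refine h.assumption.le_gradPhi_apply h.le_two h.residual
    (le_trans ?_ (h.assumption.c_mul_r_le h.K_pos h.alpha_pos))
  exact mul_le_mul_of_nonneg_left ((h.norm_F_sub_le hx).trans
    (mul_le_mul_of_nonneg_left (h.ball x hx) h.lip_pos.le)) h.assumption.c_pos.le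

/-- Coercivity of the gradient in the region of convergence. -/
theorem gam_mul_breg_le (h : P.Level y α dα C M u) (hx : breg u x ≤ dα) :
    P.gam * α * breg u x ≤ ‖P.gradPhi α x‖ * ‖x - u‖ := by
  have h1 := h.le_gradPhi_apply hx
  have h2 := (le_abs_self _).trans ((P.gradPhi α x).le_opNorm (x - u))
  linarith [h.minimizer x]

theorem cAbar_mul_sq_le (h : P.Level y α dα C M u) (hx : breg u x ≤ dα) :
    P.cAbar α * ‖x - u‖ ^ 2 ≤ breg u x := by
  rw [norm_sub_rev]
  refine breg_ge h.le_two ?_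
  have := h.ball x hx
  rw [norm_sub_rev] at this
  linarith [h.norm_le, h.r_pos]

/-- The dual step changes J_p x by −t∇Φ_α(x), so the symmetrized Bregman distance measures the first
order decrease. -/
theorem breg_step_add (t : ℝ) (x : ellp p) :
    breg (P.dualStep α t x) x + breg x (P.dualStep α t x) =
      -(t * P.gradPhi α x (P.dualStep α t x - x)) := by
  rw [breg_add_breg, Jp_dualStep]
  simp

/-- Relative smoothness of `Φ_α` along the dual gradient curve. -/
theorem Phi_dualStep_le (h : P.Level y α dα C M u) (hx : breg u x ≤ dα) {t : ℝ} (ht0 : 0 ≤ t)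
    (ht : t ≤ 1 / (2 * M)) :
    P.Phi α (P.dualStep α t x) ≤ P.Phi α x + P.gradPhi α x (P.dualStep α t x - x) +
      M * breg (P.dualStep α t x) x := by
  set z := P.dualStep α t x with hz
  set κ := P.kappa α dα with hκ
  set B := P.L * P.r α + P.K with hB
  set R := P.c * dα + B * P.r α + P.s * P.rho * α with hR
  set T := P.T α C with hT
  set cp := P.cpAlpha α dα C with hcp
  have hκ0 : 0 < κ := h.kappa_pos
  have hT0 : 0 < T := h.T_pos
  have hcp0 : 0 < cp := h.cpAlpha_pos
  have htT : t ≤ T := ht.trans h.inv_two_M_le_T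
  have hJx := h.norm_Jp_le_of_mem hx
  have hg := h.norm_gradPhi_le hx
  have hc := h.assumption.c_pos
  -- Bounds x and the new point z alike through their duals; ‖z‖ + ‖z − x‖ ≤ 3N explains the factor
  -- 3 in `cpAlpha`.
  set N := ((P.r α + P.A) ^ (p - 1) + T * κ) ^ (Real.conjExponent p - 1) with hN
  have hNx : ‖x‖ ≤ N := norm_le_of_norm_Jp_le (hJx.trans (by nlinarith))
  have hNz : ‖z‖ ≤ N := by
    refine norm_le_of_norm_Jp_le ?_
    rw [hz, Jp_dualStep]
    refine (norm_sub_le _ _).trans (add_le_add hJx ?_)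
    rw [norm_smul, Real.norm_of_nonneg ht0]
    exact mul_le_mul htT hg (norm_nonneg _) hT0.le
  set a := ‖z - x‖ with ha
  have ha0 : 0 ≤ a := norm_nonneg _
  set D := breg z x with hD
  have hD0 : 0 ≤ D := breg_nonneg h.le_two _ _
  have h1 : cp * a ^ 2 ≤ D := by
    refine breg_ge h.le_two ?_
    have := norm_sub_le z x
    linarith
  have h2 : cp * a ^ 2 ≤ breg x z := by
    rw [ha, norm_sub_rev]
    refine breg_ge h.le_two ?_
    have := norm_sub_le x z
    linarith
  have h3 : D + breg x z ≤ T * κ * a := by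
    have e := breg_step_add (P := P) (α := α) t x
    rw [← hz, ← hD] at e
    rw [e, ← mul_neg, mul_assoc]
    have h4 : -(P.gradPhi α x (z - x)) ≤ κ * a :=
      (neg_le_abs _).trans (((P.gradPhi α x).le_opNorm _).trans
        (mul_le_mul_of_nonneg_right hg ha0))
    have h5 : 0 ≤ κ * a := by positivity
    nlinarith
  -- Maximize T κ a − cp a² over a. This bound makes the quadratic term c²D² linear in D.
  have h4 : D ≤ T ^ 2 * κ ^ 2 / (2 * cp) := by
    rw [le_div_iff₀ (by positivity)]
    have h6 : D ≤ T * κ * a - cp * a ^ 2 := by linarith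
    have h7 := mul_le_mul_of_nonneg_left h6 hcp0.le
    have h8 : 0 ≤ cp * D := by positivity
    nlinarith [sq_nonneg (T * κ - 2 * cp * a)]
  have hΔ : ‖P.F z - P.F x‖ ≤ B * a + P.c * D := by
    have e : P.F z - P.F x =
        fderiv ℝ P.F x (z - x) + (P.F z - P.F x - fderiv ℝ P.F x (z - x)) := by abel
    rw [e]
    refine (norm_add_le _ _).trans (add_le_add ?_ (h.assumption.nonlinearity z x))
    exact ((fderiv ℝ P.F x).le_opNorm _).trans
      (mul_le_mul_of_nonneg_right (h.norm_fderiv_le hx) ha0)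
  have h5 : 1 / 2 * ‖P.F z - P.F x‖ ^ 2 ≤ B ^ 2 * a ^ 2 + P.c ^ 2 * D ^ 2 := by
    have := pow_le_pow_left₀ (norm_nonneg _) hΔ 2
    nlinarith [sq_nonneg (B * a - P.c * D)]
  have h6 : B ^ 2 * a ^ 2 ≤ B ^ 2 / cp * D := by
    have : a ^ 2 ≤ D / cp := by rw [le_div_iff₀ hcp0]; linarith
    calc B ^ 2 * a ^ 2 ≤ B ^ 2 * (D / cp) := mul_le_mul_of_nonneg_left this (sq_nonneg _)
      _ = _ := by ring
  have h7 : P.c ^ 2 * D ^ 2 ≤ P.c ^ 2 * T ^ 2 * κ ^ 2 / (2 * cp) * D := by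
    calc P.c ^ 2 * D ^ 2 = P.c ^ 2 * D * D := by ring
      _ ≤ P.c ^ 2 * D * (T ^ 2 * κ ^ 2 / (2 * cp)) := mul_le_mul_of_nonneg_left h4 (by positivity)
      _ = _ := by ring
  have h8 := (le_abs_self _).trans
    (h.assumption.abs_inner_remainder_le x z (P.F x - P.ydelta))
  have h9 : ‖P.F x - P.ydelta‖ * (P.c * D) ≤ R * (P.c * D) :=
    mul_le_mul_of_nonneg_right (h.norm_residual_le hx) (by positivity)
  have h10 := mul_le_mul_of_nonneg_right h.M_ge_relSmooth hD0
  rw [P.Phi_expand α z x]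
  linarith

/-- With S the symmetrized Bregman distance, the linear term is −S/t, while t ≤ 1/(2M) bounds the
smoothness error by S/(2t); half of the decrease survives. -/
theorem Phi_dualStep_add_le (h : P.Level y α dα C M u) (hx : breg u x ≤ dα) {t : ℝ} (ht0 : 0 < t)
    (ht : t ≤ 1 / (2 * M)) :
    P.Phi α (P.dualStep α t x) +
      (breg (P.dualStep α t x) x + breg x (P.dualStep α t x)) / (2 * t) ≤ P.Phi α x := by
  have h1 := h.Phi_dualStep_le hx ht0.le ht
  have h2 := breg_step_add (P := P) (α := α) t x
  have hb := breg_nonneg h.le_two x (P.dualStep α t x)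
  have hb' := breg_nonneg h.le_two (P.dualStep α t x) x
  set S := breg (P.dualStep α t x) x + breg x (P.dualStep α t x) with hS
  have hM := h.M_pos
  have h3 : M ≤ 1 / (2 * t) := by
    rw [le_div_iff₀ (by positivity)] at ht ⊢
    linarith
  have h4 : M * breg (P.dualStep α t x) x ≤ 1 / (2 * t) * S :=
    mul_le_mul h3 (by linarith) hb' (by positivity)
  have h5 : P.gradPhi α x (P.dualStep α t x - x) = -(S / t) := by
    rw [h2]; field_simp
  have h6 : S / t = 1 / (2 * t) * S + S / (2 * t) := by field_simp; ring
  linarith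

/-- A dual gradient step does not leave the region of convergence. -/
theorem breg_dualStep_le (h : P.Level y α dα C M u) (hx : breg u x ≤ dα) {t : ℝ} (ht0 : 0 < t)
    (ht : t ≤ 1 / (2 * M)) : breg u (P.dualStep α t x) ≤ dα := by
  have h1 := h.Phi_dualStep_le hx ht0.le ht
  have h2 := h.le_gradPhi_apply hx
  have h3 := h.minimizer (P.dualStep α t x)
  have hD : 0 ≤ P.gam * α * breg u x := mul_nonneg h.gam_mul_pos.le (breg_nonneg h.le_two _ _)
  have hb := breg_nonneg h.le_two (P.dualStep α t x) x
  have hM := h.M_pos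
  have h4 : t * M ≤ 1 := by
    rw [le_div_iff₀ (by positivity)] at ht
    nlinarith
  have h5 := breg_three_point u (P.dualStep α t x) x
  rw [Jp_dualStep] at h5
  have h6 : (Jp x - t • P.gradPhi α x - Jp x) (u - P.dualStep α t x) =
      t * (P.gradPhi α x (x - u) + P.gradPhi α x (P.dualStep α t x - x)) := by
    simp only [map_sub, sub_apply, smul_apply, smul_eq_mul]
    ring
  rw [h6] at h5
  set z := P.dualStep α t x
  -- Sum of directional convexity, relative smoothness and minimality of u. With t M ≤ 1 the error
  -- is absorbed by −D(z, x) in the three point identity.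
  have h7 : P.gradPhi α x (x - u) + P.gradPhi α x (z - x) ≥ -(M * breg z x) := by linarith
  have h8 := mul_le_mul_of_nonneg_left h7 ht0.le
  nlinarith

/-- Steps bounded away from `0` decrease `Φ_α` by a fixed amount as long as the inner stopping
rule is not satisfied. -/
theorem exists_decrease (h : P.Level y α dα C M u) {t₀ : ℝ} (ht₀ : 0 < t₀) :
    ∃ ε > 0, ∀ x, breg u x ≤ dα → ¬ P.InnerStop α C x → ∀ t, t₀ ≤ t → t ≤ 1 / (2 * M) →
      P.Phi α (P.dualStep α t x) ≤ P.Phi α x - ε := by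
  have hC := h.C_pos
  have hcpt := smoothness_const_pos h.smooth
  have hp1 : 0 < p - 1 := by linarith [hp.out]
  -- Solves cpt * l ^ p = t₀ * C * l / 2, so that half of t‖∇Φ‖l remains as a lower bound for D(x,
  -- z).
  set l := (t₀ * C / (2 * P.cpt)) ^ (1 / (p - 1)) with hl
  have hl0 : 0 < l := by positivity
  have hlp : P.cpt * l ^ p = t₀ * C / 2 * l := by
    have h1 : l ^ (p - 1) = t₀ * C / (2 * P.cpt) := by
      rw [hl, ← Real.rpow_mul (by positivity), one_div_mul_cancel hp1.ne', Real.rpow_one]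
    have h2 : l ^ p = l ^ (p - 1) * l := by rw [Real.rpow_sub_one hl0.ne']; field_simp
    rw [h2, h1]; field_simp
  refine ⟨l * C / 4, by positivity, fun x hx hs t ht ht' => ?_⟩
  have ht0 : 0 < t := ht₀.trans_le ht
  have h1 := h.Phi_dualStep_add_le hx ht0 ht'
  have h2 := norm_Jp_sub_mul_le h.smooth h.le_two x (P.dualStep α t x) hl0
  have hb' := breg_nonneg h.le_two (P.dualStep α t x) x
  have h3 : ‖Jp (P.dualStep α t x) - Jp x‖ = t * ‖P.gradPhi α x‖ := by
    rw [Jp_dualStep, sub_sub_cancel_left, norm_neg, norm_smul, Real.norm_of_nonneg ht0.le]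
  have h4 : C ≤ ‖P.gradPhi α x‖ := (not_le.mp hs).le
  rw [h3, hlp] at h2
  have h5 : t * C * l ≤ t * ‖P.gradPhi α x‖ * l := by gcongr
  have h6 : t₀ * C / 2 * l ≤ t * C / 2 * l := by gcongr
  have h7 : l * C / 4 ≤
      (breg (P.dualStep α t x) x + breg x (P.dualStep α t x)) / (2 * t) := by
    rw [le_div_iff₀ (by positivity)]
    linarith
  linarith

theorem stepSize_le (P : Problem p Y) (α M : ℝ) (x : ellp p) :
    P.stepSize α M x ≤ 1 / (2 * M) := min_le_right _ _

/-- The step sizes are bounded away from `0`. -/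
theorem exists_le_stepSize (h : P.Level y α dα C M u) :
    ∃ t₀ > 0, ∀ x, breg u x ≤ dα → ¬ P.InnerStop α C x → t₀ ≤ P.stepSize α M x := by
  have hM := h.M_pos
  have hC := h.C_pos
  have hr := h.r_pos
  have hα := h.alpha_pos
  have hK := h.K_pos
  have hL := h.assumption.L_pos
  have hs := h.assumption.s_pos
  have hρ := h.assumption.rho_pos
  have hcA := h.cAbar_pos
  have hcpt := smoothness_const_pos h.smooth
  have hκ := h.kappa_pos
  have hγ := h.assumption.gam_pos
  -- Only the step 1/(2M) is tested here: the line search infimum lies below its value, so the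
  -- numerator of `cbar` has a uniform lower bound.
  obtain ⟨ε, hε, hdec⟩ := h.exists_decrease (t₀ := 1 / (2 * M)) (by positivity)
  set den := 4 * P.K ^ 2 + 4 * P.L * P.s * P.rho * α + 4 * P.L * P.K * P.r α +
    P.L ^ 2 * P.r α ^ 2 + 8 * α * P.cpt * P.cAbar α ^ ((2 - p) / 2) with hden
  have hden0 : 0 < den := by positivity
  set c₀ := min 1 (8 * P.cAbar α * ε / den) with hc₀
  have hc₀0 : 0 < c₀ := lt_min one_pos (by positivity)
  refine ⟨min (P.gam * c₀ * α / P.kappa α dα ^ 2) (1 / (2 * M)),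
    lt_min (by positivity) (by positivity), fun x hx hst => ?_⟩
  have hg : C < ‖P.gradPhi α x‖ := not_le.mp hst
  have hg0 : 0 < ‖P.gradPhi α x‖ := hC.trans hg
  have hφ : P.phiMin α x ≤ P.Phi α x - ε := by
    have hbdd : BddBelow ((fun t => P.Phi α (P.dualStep α t x)) '' Set.Ioi 0) := by
      refine ⟨0, ?_⟩
      rintro _ ⟨t, -, rfl⟩
      exact P.Phi_nonneg hα.le _
    have hpos : 1 / (2 * M) ∈ Set.Ioi (0 : ℝ) := Set.mem_Ioi.mpr (by positivity)
    exact (csInf_le hbdd (Set.mem_image_of_mem _ hpos)).trans (hdec x hx hst _ le_rfl le_rfl)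
  have hcbar : c₀ ≤ P.cbar α x := by
    refine min_le_min_left _ (div_le_div_of_nonneg_right ?_ hden0.le)
    exact mul_le_mul_of_nonneg_left (by linarith) (by positivity)
  refine min_le_min_right _ (div_le_div₀ ?_ ?_ (by positivity) ?_)
  · have := hc₀0.trans_le hcbar
    positivity
  · gcongr
  · have := h.norm_gradPhi_le hx
    gcongr

/-- At a vanishing gradient the division by zero makes the step size 0; failure of the stopping rule
excludes this. -/
theorem stepSize_pos (h : P.Level y α dα C M u) (hx : breg u x ≤ dα)
    (hs : ¬ P.InnerStop α C x) : 0 < P.stepSize α M x := by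
  obtain ⟨t₀, ht₀, hle⟩ := h.exists_le_stepSize
  exact ht₀.trans_le (hle x hx hs)

theorem breg_inner_le (h : P.Level y α dα C M u) (hx : breg u x ≤ dα) (k : ℕ)
    (hk : ∀ i < k, ¬ P.InnerStop α C (P.inner α M x i)) : breg u (P.inner α M x k) ≤ dα := by
  induction k with
  | zero => exact hx
  | succ k ih =>
    have h1 := ih fun i hi => hk i (hi.trans (Nat.lt_succ_self k))
    exact h.breg_dualStep_le h1 (h.stepSize_pos h1 (hk k (Nat.lt_succ_self k)))
      (stepSize_le P α M _)

/-- The inner iteration satisfies its stopping rule after finitely many steps. -/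
theorem exists_innerStop (h : P.Level y α dα C M u) (hx : breg u x ≤ dα) :
    ∃ k, P.InnerStop α C (P.inner α M x k) := by
  by_contra! hns
  obtain ⟨t₀, ht₀, hle⟩ := h.exists_le_stepSize
  obtain ⟨ε, hε, hdec⟩ := h.exists_decrease ht₀
  have hmem : ∀ k, breg u (P.inner α M x k) ≤ dα := fun k => h.breg_inner_le hx k fun i _ => hns i
  have hk : ∀ k : ℕ, P.Phi α (P.inner α M x k) ≤ P.Phi α x - k * ε := fun k => by
    induction k with
    | zero => simp [Problem.inner]
    | succ k ih =>
      have := hdec _ (hmem k) (hns k) _ (hle _ (hmem k) (hns k)) (stepSize_le P α M _)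
      rw [Problem.inner]
      push_cast
      linarith
  -- More than Φ(x)/ε decreases of size ε would make Φ negative.
  obtain ⟨k, hk'⟩ := exists_nat_gt (P.Phi α x / ε)
  rw [div_lt_iff₀ hε] at hk'
  linarith [hk k, P.Phi_nonneg h.alpha_pos.le (P.inner α M x k)]

/-- Needs the existence result, since the infimum of an empty set of indices would be 0. -/
theorem innerStop_kStop (h : P.Level y α dα C M u) (hx : breg u x ≤ dα) :
    P.InnerStop α C (P.inner α M x (P.kStop α C M x)) :=
  Nat.sInf_mem (s := {k | P.InnerStop α C (P.inner α M x k)}) (h.exists_innerStop hx)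

theorem breg_inner_le_of_le_kStop (h : P.Level y α dα C M u) (hx : breg u x ≤ dα) {k : ℕ}
    (hk : k ≤ P.kStop α C M x) : breg u (P.inner α M x k) ≤ dα :=
  h.breg_inner_le hx k fun _ hi => Nat.notMem_of_lt_sInf (hi.trans_le hk)

/-- Points which satisfy the inner stopping rule are close to the minimizer in Bregman distance. -/
theorem breg_le_of_innerStop (h : P.Level y α dα C M u) (hx : breg u x ≤ dα)
    (hs : P.InnerStop α C x) {e : ℝ} (hC : C ≤ P.gam * α * (e / (3 * P.r α))) :
    breg u x ≤ e / 3 := by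
  have hr := h.r_pos
  have h1 := h.gam_mul_breg_le hx
  have h2 : ‖P.gradPhi α x‖ * ‖x - u‖ ≤ C * P.r α :=
    mul_le_mul hs (h.ball x hx) (norm_nonneg _) h.C_pos.le
  have h3 : C * P.r α ≤ P.gam * α * (e / 3) := by
    refine (mul_le_mul_of_nonneg_right hC hr.le).trans (le_of_eq ?_)
    field_simp
  exact le_of_mul_le_mul_left (h1.trans (h2.trans h3)) h.gam_mul_pos

/-- Points which satisfy the inner stopping rule have almost the same image as the minimizer. -/
theorem norm_F_sub_le_of_innerStop (h : P.Level y α dα C M u) (hx : breg u x ≤ dα)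
    (hs : P.InnerStop α C x)
    (hC : C ≤ P.gam * α *
      (P.delta * P.cAbar α / (P.K + P.r α * (P.c * P.cAbar α + P.L)))) :
    ‖P.F x - P.F u‖ ≤ P.delta := by
  have hr := h.r_pos
  have hcA := h.cAbar_pos
  have hK := h.K_pos
  have hc := h.assumption.c_pos
  have hL := h.assumption.L_pos
  have hδ := h.delta_pos
  have hgα := h.gam_mul_pos
  have h1 := h.gam_mul_breg_le hx
  have h2 : ‖P.gradPhi α x‖ * ‖x - u‖ ≤ C * ‖x - u‖ :=
    mul_le_mul_of_nonneg_right hs (norm_nonneg _)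
  have h3 := h.cAbar_mul_sq_le hx
  refine (h.norm_F_sub_le hx).trans ?_
  rcases (norm_nonneg (x - u)).eq_or_lt with h0 | h0
  · rw [← h0, mul_zero]; exact hδ.le
  -- Coercivity against the quadratic lower bound for D, with one factor ‖x − u‖ cancelled.
  have h4 : P.gam * α * (P.cAbar α * ‖x - u‖) ≤ C := by
    refine le_of_mul_le_mul_right ?_ h0
    nlinarith
  have h5 : P.cAbar α * ‖x - u‖ ≤
      P.delta * P.cAbar α / (P.K + P.r α * (P.c * P.cAbar α + P.L)) :=
    le_of_mul_le_mul_left (h4.trans hC) hgα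
  rw [le_div_iff₀ (by positivity)] at h5
  have h6 : ‖x - u‖ * (P.K + P.r α * (P.c * P.cAbar α + P.L)) ≤ P.delta := by
    refine le_of_mul_le_mul_left ?_ hcA
    linarith
  -- This summand of the denominator is slack and is dropped.
  have h7 : 0 ≤ ‖x - u‖ * (P.r α * (P.c * P.cAbar α)) := by positivity
  nlinarith

end Level

end Problem

end TIGRA

/-! ### Dependence on α and the outer iteration -/

namespace TIGRA

namespace Problem

variable {p : ℝ} [hp : Fact (1 < p)] {Y : Type*} [NormedAddCommGroup Y] [InnerProductSpace ℝ Y]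
  {P : Problem p Y} {y : Y}

/-- Global growth of `Φ_α` away from a minimizer. -/
theorem Assumption.growth (hA : P.Assumption y) (hp2 : p ≤ 2) {α : ℝ} {u : ellp p}
    (hg : P.gradPhi α u = 0) (hres : ‖P.F u - P.ydelta‖ ≤ P.s * P.rho * α) (z : ellp p) :
    P.Phi α u + 2 * P.gam * α * breg z u ≤ P.Phi α z := by
  have h := P.Phi_expand α z u
  rw [hg] at h
  have h1 := neg_le_of_abs_le (hA.abs_inner_remainder_le u z (P.F u - P.ydelta))
  have hD := breg_nonneg hp2 z u
  have h2 : ‖P.F u - P.ydelta‖ * (P.c * breg z u) ≤ P.s * P.rho * α * (P.c * breg z u) :=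
    mul_le_mul_of_nonneg_right hres (mul_nonneg hA.c_pos.le hD)
  have h3 : 2 * P.gam * α * breg z u = α * breg z u - P.s * P.rho * α * (P.c * breg z u) := by
    rw [gam]; ring
  have h4 : (0 : StrongDual ℝ (ellp p)) (z - u) = 0 := rfl
  nlinarith [sq_nonneg ‖P.F z - P.F u‖]

theorem Assumption.sigma_nonneg (hA : P.Assumption y) (hδ : 0 < P.delta) (hK : 0 < P.K) :
    0 ≤ P.sigma := by
  have h1 := hA.A_nonneg hδ
  have h2 := hA.s_pos
  have h3 := hA.rho_pos
  have h4 := hA.alphaStar_pos hδ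
  have h5 : 0 < 1 - P.s * P.c * P.rho := by linarith [hA.scrho_lt]
  have h6 : 0 < p - 1 := by linarith [hp.out]
  unfold sigma cA
  positivity

/-- Lipschitz dependence of the minimizers on the regularization parameter. -/
theorem Assumption.norm_minimizer_sub_le (hA : P.Assumption y) (hp2 : p ≤ 2) (hδ : 0 < P.delta)
    (hy : ‖y - P.ydelta‖ ≤ P.delta) (hK : 0 < P.K)
    (hcpt : ∀ x z : ellp p, breg z x ≤ P.cpt * ‖x - z‖ ^ p) {α α' : ℝ} (hα' : P.alphaStar ≤ α')
    (hαα' : α' ≤ α) {u u' : ellp p} (hu : ∀ x, P.Phi α u ≤ P.Phi α x)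
    (hu' : ∀ x, P.Phi α' u' ≤ P.Phi α' x) : ‖u' - u‖ ≤ P.sigma * (α - α') := by
  have hα := hα'.trans hαα'
  have hs0 := hA.alphaStar_pos hδ
  have hα'0 := hs0.trans_le hα'
  have hα0 := hs0.trans_le hα
  have hσ := mul_nonneg (hA.sigma_nonneg hδ hK) (sub_nonneg.mpr hαα')
  have hn := hA.norm_minimizer_le hδ hα hu
  have hn' := hA.norm_minimizer_le hδ hα' hu'
  rcases (norm_nonneg (u' - u)).eq_or_lt with h0 | h0
  · rwa [← h0]
  -- Distinct minimizers in the ball of radius A force A > 0, so `cA` is a genuine positive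
  -- constant. For A = 0 and p < 2 the conventions 0 ^ (p - 2) = 0 and division by zero give σ = 0.
  have hA0 : 0 < P.A := by
    have := norm_sub_le u' u
    linarith
  have hp1 : 0 < p - 1 := by linarith [hp.out]
  have hcA : 0 < P.cA := by unfold cA; positivity
  have hγ := hA.gam_pos
  have hg' := hA.gradPhi_eq_zero hp2 hcpt hu'
  have hres' := hA.residual_le' hp2 hδ hy hα' hu'
  have h1 := hA.growth hp2 (hA.gradPhi_eq_zero hp2 hcpt hu) (hA.residual_le' hp2 hδ hy hα hu) u'
  have h2 := hA.growth hp2 hg' hres' u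
  set a := ‖u' - u‖ with ha
  have hD : P.cA * a ^ 2 ≤ breg u' u := by
    refine breg_ge hp2 ?_
    have := norm_sub_le u' u
    linarith
  have hD' : P.cA * a ^ 2 ≤ breg u u' := by
    rw [ha, norm_sub_rev]
    refine breg_ge hp2 ?_
    have := norm_sub_le u u'
    linarith
  -- The optimality condition at u' trades the penalty gradient for the residual, whose bound sϱα'
  -- cancels the factor α'.
  have h3 : Jp u' (u' - u) ≤ P.s * P.rho * P.K * a := by
    have e1 : α' * Jp u' (u' - u) =
        -Inner.inner ℝ (P.F u' - P.ydelta) (fderiv ℝ P.F u' (u' - u)) := by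
      have := P.gradPhi_apply α' u' (u' - u)
      rw [hg'] at this
      have h4 : (0 : StrongDual ℝ (ellp p)) (u' - u) = 0 := rfl
      linarith
    have e2 : -Inner.inner ℝ (P.F u' - P.ydelta) (fderiv ℝ P.F u' (u' - u)) ≤
        P.s * P.rho * α' * (P.K * a) := by
      refine (neg_le_abs _).trans ((abs_real_inner_le_norm _ _).trans ?_)
      refine mul_le_mul hres' ?_ (norm_nonneg _) ((norm_nonneg _).trans hres')
      exact ((fderiv ℝ P.F u').le_opNorm _).trans
        (mul_le_mul_of_nonneg_right (hA.norm_fderiv_le_K hn') h0.le)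
    refine le_of_mul_le_mul_left ?_ hα'0
    linarith
  have h4 : fp u' - fp u ≤ Jp u' (u' - u) := by
    have h5 := breg_nonneg hp2 u u'
    have h6 : Jp u' (u - u') = -Jp u' (u' - u) := by rw [← map_neg, neg_sub]
    rw [breg, h6] at h5
    linarith
  have h5 : (α - α') * (fp u' - fp u) ≤ (α - α') * (P.s * P.rho * P.K * a) :=
    mul_le_mul_of_nonneg_left (h4.trans h3) (by linarith)
  have h6 : 2 * P.gam * P.alphaStar * (P.cA * a ^ 2) ≤ 2 * P.gam * α * breg u' u := by
    gcongr
  have h7 : 2 * P.gam * P.alphaStar * (P.cA * a ^ 2) ≤ 2 * P.gam * α' * breg u u' := by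
    gcongr
  -- Adding the two growth inequalities cancels the residuals and leaves (α − α')(f_p(u') − f_p(u)).
  -- The result is four times better than σ requires.
  have h8 : 4 * P.gam * P.alphaStar * P.cA * a ≤ (α - α') * (P.s * P.rho * P.K) := by
    refine le_of_mul_le_mul_right ?_ h0
    simp only [Phi] at h1 h2
    nlinarith
  have e1 : 1 - P.s * P.c * P.rho = 2 * P.gam := by rw [gam]; ring
  have hs := hA.s_pos
  have hρ := hA.rho_pos
  have h9 : 0 ≤ (α - α') * (P.s * P.rho * P.K) :=
    mul_nonneg (by linarith) (by positivity)
  rw [sigma, e1, div_mul_eq_mul_div, le_div_iff₀ (by positivity)]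
  linarith

/-- The change of the regularization parameter: a point whose Bregman distance to the old minimizer
is at most a third of the new radius lies in the new region of convergence. -/
theorem breg_minimizer_le (hp2 : p ≤ 2) (hA : P.Assumption y) (hδ : 0 < P.delta)
    (hcpt : ∀ x z : ellp p, breg z x ≤ P.cpt * ‖x - z‖ ^ p) {α₀ b e R : ℝ} {u u' x : ellp p}
    (hb : 0 ≤ b) (hu : ‖u‖ ≤ P.A) (huu' : ‖u' - u‖ ≤ b) (hx : ‖x - u‖ ≤ R) (hR : R ≤ P.r α₀)
    (hbe : P.rhoMax α₀ * b ≤ min (e / 3) 1) (hD : breg u x ≤ e / 3) : breg u' x ≤ e := by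
  have hp1 : 0 < p - 1 := by linarith [hp.out]
  have hp0 : 0 < p := by linarith
  have hA0 := hA.A_nonneg hδ
  have hcp := smoothness_const_pos hcpt
  -- Three terms, each to be bounded by e / 3.
  have h1 : breg u' x = breg u x + breg u' u + (Jp u - Jp x) (u' - u) := by
    simp only [breg, map_sub, sub_apply]; ring
  have h2 : breg u' u ≤ e / 3 := by
    have h3 : P.cpt ^ (1 / p) * b ≤ min (e / 3) 1 :=
      (mul_le_mul_of_nonneg_right (le_max_left _ _) hb).trans hbe
    have h4 : 0 ≤ P.cpt ^ (1 / p) * b := by positivity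
    calc breg u' u ≤ P.cpt * ‖u' - u‖ ^ p := by rw [norm_sub_rev]; exact hcpt _ _
      _ ≤ P.cpt * b ^ p := by gcongr
      _ = (P.cpt ^ (1 / p) * b) ^ p := by
          rw [Real.mul_rpow (by positivity) hb, ← Real.rpow_mul hcp.le,
            one_div_mul_cancel hp0.ne', Real.rpow_one]
      _ ≤ P.cpt ^ (1 / p) * b :=
          -- The cap 1 in the condition on q̄ is there for this: t ^ p ≤ t when t ≤ 1.
          Real.rpow_le_self_of_le_one h4 (h3.trans (min_le_right _ _)) hp.out.le
      _ ≤ e / 3 := h3.trans (min_le_left _ _)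
  have h3 : (Jp u - Jp x) (u' - u) ≤ e / 3 := by
    have hR0 : 0 ≤ R := (norm_nonneg _).trans hx
    have h4 : ‖Jp u - Jp x‖ ≤ 2 * P.A ^ (p - 1) + P.r α₀ ^ (p - 1) := by
      have hxn : ‖x‖ ≤ P.A + P.r α₀ := by
        have := norm_le_norm_add_norm_sub' x u
        linarith
      have h5 : ‖Jp x‖ ≤ P.A ^ (p - 1) + P.r α₀ ^ (p - 1) :=
        ((norm_Jp_le x).trans (Real.rpow_le_rpow (norm_nonneg _) hxn hp1.le)).trans
          (Real.rpow_add_le_add_rpow hA0 (hR0.trans hR) hp1.le (by linarith))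
      have h6 : ‖Jp u‖ ≤ P.A ^ (p - 1) :=
        (norm_Jp_le u).trans (Real.rpow_le_rpow (norm_nonneg _) hu hp1.le)
      have := norm_sub_le (Jp u) (Jp x)
      linarith
    calc (Jp u - Jp x) (u' - u) ≤ ‖Jp u - Jp x‖ * ‖u' - u‖ :=
          (le_abs_self _).trans ((Jp u - Jp x).le_opNorm _)
      _ ≤ P.rhoMax α₀ * b :=
          mul_le_mul (h4.trans (le_max_right _ _)) huu' (norm_nonneg _)
            ((norm_nonneg _).trans (h4.trans (le_max_right _ _)))
      _ ≤ e / 3 := hbe.trans (min_le_left _ _)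
  linarith

theorem Assumption.qbar0_pos (hA : P.Assumption y) : 0 < P.qbar0 := by
  have := hA.s_pos
  have := hA.c_pos
  have := hA.rho_pos
  unfold qbar0
  positivity

section Algorithm

variable {xm : ℝ → ellp p} {d : ℝ → ℝ} {Q : Param p}

theorem ParamChoice.level (hQ : P.ParamChoice xm d Q) (hp2 : p ≤ 2) (hδ : 0 < P.delta)
    (hy : ‖y - P.ydelta‖ ≤ P.delta) (hcpt : ∀ x z : ellp p, breg z x ≤ P.cpt * ‖x - z‖ ^ p)
    (hA : P.Assumption y) (hK : 0 < P.K) (hxm : P.IsMinimizerFamily xm)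
    (hd : P.IsRegionRadius xm d) {j : ℕ} (hj : P.alphaStar ≤ Q.alpha j) :
    P.Level y (Q.alpha j) (d (Q.alpha j)) (Q.C j) (Q.M j) (xm (Q.alpha j)) where
  le_two := hp2
  delta_pos := hδ
  smooth := hcpt
  assumption := hA
  K_pos := hK
  alpha_pos := (hA.alphaStar_pos hδ).trans_le hj
  d_pos := hd.pos _ hj
  C_pos := hQ.C_pos j hj
  M_ge := hQ.M_ge j hj
  minimizer := hxm _ hj
  norm_le := hA.norm_minimizer_le hδ hj (hxm _ hj)
  residual := hA.residual_le' hp2 hδ hy hj (hxm _ hj)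
  ball := hd.ball_subset _ hj

theorem ParamChoice.qbar_pos (hQ : P.ParamChoice xm d Q) (hA : P.Assumption y) : 0 < Q.qbar :=
  hA.qbar0_pos.trans hQ.qbar_gt

theorem ParamChoice.alpha0_pos (hQ : P.ParamChoice xm d Q) (hδ : 0 < P.delta)
    (hA : P.Assumption y) : 0 < Q.alpha0 := (hA.alphaStar_pos hδ).trans_le hQ.alpha0_ge

theorem Param.alpha_succ {p : ℝ} (Q : Param p) (j : ℕ) : Q.alpha (j + 1) = Q.qbar * Q.alpha j := by
  rw [Param.alpha, Param.alpha, pow_succ]; ring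

theorem ParamChoice.alpha_antitone (hQ : P.ParamChoice xm d Q) (hδ : 0 < P.delta)
    (hA : P.Assumption y) : Antitone Q.alpha := fun _ _ hij =>
  mul_le_mul_of_nonneg_right
    (pow_le_pow_of_le_one (hQ.qbar_pos hA).le hQ.qbar_lt.le hij) (hQ.alpha0_pos hδ hA).le

/-- There is a last level with `α_j ≥ α_*`. -/
theorem ParamChoice.exists_last_level (hQ : P.ParamChoice xm d Q) (hδ : 0 < P.delta)
    (hA : P.Assumption y) :
    ∃ j, P.alphaStar ≤ Q.alpha j ∧ Q.alpha (j + 1) < P.alphaStar := by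
  have hs := hA.alphaStar_pos hδ
  have hα0 := hQ.alpha0_pos hδ hA
  have hex : ∃ n, Q.alpha n < P.alphaStar := by
    obtain ⟨n, hn⟩ := exists_pow_lt_of_lt_one (div_pos hs hα0) hQ.qbar_lt
    exact ⟨n, by rwa [lt_div_iff₀ hα0] at hn⟩
  classical
  rcases hn : Nat.find hex with _ | j
  · have := Nat.find_spec hex
    rw [hn, Param.alpha, pow_zero, one_mul] at this
    exact absurd hQ.alpha0_ge (not_le.mpr this)
  · have h1 := Nat.find_spec hex
    rw [hn] at h1
    exact ⟨j, not_lt.mp (Nat.find_min hex (m := j) (by omega)), h1⟩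

/-- The starting values of all levels lie in the region of convergence. -/
theorem ParamChoice.breg_start_le (hQ : P.ParamChoice xm d Q) (hp2 : p ≤ 2) (hδ : 0 < P.delta)
    (hy : ‖y - P.ydelta‖ ≤ P.delta) (hcpt : ∀ x z : ellp p, breg z x ≤ P.cpt * ‖x - z‖ ^ p)
    (hA : P.Assumption y) (hK : 0 < P.K) (hxm : P.IsMinimizerFamily xm)
    (hd : P.IsRegionRadius xm d) (j : ℕ) (hj : P.alphaStar ≤ Q.alpha j) :
    breg (xm (Q.alpha j)) (P.start Q j) ≤ d (Q.alpha j) := by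
  induction j with
  | zero => simpa [Param.alpha, start] using hQ.init
  | succ j ih =>
    have hanti := hQ.alpha_antitone hδ hA
    have hle : Q.alpha (j + 1) ≤ Q.alpha j := hanti (Nat.le_succ j)
    have hj' : P.alphaStar ≤ Q.alpha j := hj.trans hle
    have hlev := hQ.level hp2 hδ hy hcpt hA hK hxm hd hj'
    have h1 := ih hj'
    have h2 := hlev.breg_inner_le_of_le_kStop h1 le_rfl
    have h3 : Q.C j ≤ P.gam * Q.alpha j * (d (Q.alpha (j + 1)) / (3 * P.r (Q.alpha j))) := by
      have := hQ.C_le j hj'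
      rw [max_eq_left hj] at this
      exact this.trans (mul_le_mul_of_nonneg_left (min_le_left _ _) hlev.gam_mul_pos.le)
    have h4 := hlev.breg_le_of_innerStop h2 (hlev.innerStop_kStop h1) h3
    have h5 := hA.norm_minimizer_sub_le hp2 hδ hy hK hcpt hj hle (hxm _ hj') (hxm _ hj)
    have hσ := hA.sigma_nonneg hδ hK
    have hα00 : Q.alpha 0 = Q.alpha0 := by simp [Param.alpha]
    have hα0 : Q.alpha j ≤ Q.alpha0 := hα00 ▸ hanti (Nat.zero_le j)
    have h6 : P.sigma * (Q.alpha j - Q.alpha (j + 1)) ≤ P.sigma * Q.alpha0 * (1 - Q.qbar) := by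
      rw [Q.alpha_succ, mul_assoc]
      refine mul_le_mul_of_nonneg_left ?_ hσ
      have := mul_le_mul_of_nonneg_right hα0 (sub_nonneg.mpr hQ.qbar_lt.le)
      linarith
    -- The condition on q̄ involves the smallest radius d_{α_*}, so it suffices at every level.
    have h7 : d P.alphaStar ≤ d (Q.alpha (j + 1)) :=
      hd.strictMonoOn.monotoneOn Set.self_mem_Ici hj hj
    refine breg_minimizer_le hp2 hA hδ hcpt (α₀ := Q.alpha0)
      (b := P.sigma * Q.alpha0 * (1 - Q.qbar)) ?_ hlev.norm_le (h5.trans h6)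
      (hlev.ball _ h2) (hA.r_mono hK hα0) ?_ h4
    · exact mul_nonneg (mul_nonneg hσ (hQ.alpha0_pos hδ hA).le) (sub_nonneg.mpr hQ.qbar_lt.le)
    · rw [← mul_assoc, ← mul_assoc]
      exact hQ.qbar_cond.trans (min_le_min_right _ (by linarith))

/-- The discrepancy principle holds at the last level with `α_j ≥ α_*`. -/
theorem ParamChoice.outerStop_of_alpha_succ_lt (hQ : P.ParamChoice xm d Q) (hp2 : p ≤ 2)
    (hδ : 0 < P.delta) (hy : ‖y - P.ydelta‖ ≤ P.delta)
    (hcpt : ∀ x z : ellp p, breg z x ≤ P.cpt * ‖x - z‖ ^ p)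
    (hA : P.Assumption y) (hK : 0 < P.K) (hxm : P.IsMinimizerFamily xm)
    (hd : P.IsRegionRadius xm d) {j : ℕ} (hj : P.alphaStar ≤ Q.alpha j)
    (hj' : Q.alpha (j + 1) < P.alphaStar) : P.OuterStop Q j := by
  have hlev := hQ.level hp2 hδ hy hcpt hA hK hxm hd hj
  have h1 := hQ.breg_start_le hp2 hδ hy hcpt hA hK hxm hd j hj
  have h2 := hlev.breg_inner_le_of_le_kStop h1 le_rfl
  have h3 := hlev.norm_F_sub_le_of_innerStop h2 (hlev.innerStop_kStop h1)
    ((hQ.C_le j hj).trans (mul_le_mul_of_nonneg_left (min_le_right _ _) hlev.gam_mul_pos.le))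
  have h4 := hA.residual_le hp2 hδ hy hj (hxm _ hj)
  have hq := hQ.qbar_pos hA
  have hs : 0 < P.s - 2 := by linarith [hA.s_gt]
  have hρ := hA.rho_pos
  -- From q̄ α_j < α_*; this is the origin of the second term of τ.
  have h5 : P.rho * Q.alpha j ≤ P.delta / (Q.qbar * (P.s - 2)) := by
    rw [Q.alpha_succ, alphaStar, lt_div_iff₀ (by positivity)] at hj'
    rw [le_div_iff₀ (by positivity)]
    linarith
  have h6 : P.tau Q * P.delta = 2 * P.delta + 2 * (P.delta / (Q.qbar * (P.s - 2))) := by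
    rw [tau]; ring
  have h7 : P.F (P.iter Q j (P.kstar Q j)) - P.ydelta =
      (P.F (P.iter Q j (P.kstar Q j)) - P.F (xm (Q.alpha j))) +
        (P.F (xm (Q.alpha j)) - P.ydelta) := by abel
  rw [OuterStop, h7, h6]
  refine (norm_add_le _ _).trans ((add_le_add h3 h4).trans ?_)
  linarith

end Algorithm

end Problem

end TIGRA

theorem proposition4p2 (p : ℝ) [Fact (1 < p)] (hp : p ≤ 2)
    {Y : Type*} [NormedAddCommGroup Y] [InnerProductSpace ℝ Y] [CompleteSpace Y]
    (P : TIGRA.Problem p Y) (y : Y)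
    (hδ : 0 < P.delta) (hy : ‖y - P.ydelta‖ ≤ P.delta)
    (hcpt : ∀ x z : TIGRA.ellp p, TIGRA.breg z x ≤ P.cpt * ‖x - z‖ ^ p)
    (hA : P.Assumption y) (hK : 0 < P.K)
    (xm : ℝ → TIGRA.ellp p) (hxm : P.IsMinimizerFamily xm)
    (d : ℝ → ℝ) (hd : P.IsRegionRadius xm d)
    (Q : TIGRA.Problem.Param p) (hQ : P.ParamChoice xm d Q) :
    ∃ jstar : ℕ,
      -- every inner iteration up to the last level terminates
      (∀ j ≤ jstar, ∃ k, P.InnerStop (Q.alpha j) (Q.C j) (P.iter Q j k)) ∧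
      -- the generated iterates stay in the region of convergence
      (∀ j ≤ jstar, ∀ k ≤ P.kstar Q j,
        TIGRA.breg (xm (Q.alpha j)) (P.iter Q j k) ≤ d (Q.alpha j)) ∧
      -- the outer iteration stops at level `jstar` and not earlier
      (∀ j < jstar, ¬ P.OuterStop Q j) ∧
      P.OuterStop Q jstar ∧
      -- the final regularization parameter
      P.alphaStar ≤ Q.alpha jstar := by
  classical
  obtain ⟨J, hJ, hJ'⟩ := hQ.exists_last_level hδ hA
  have hex : ∃ j, P.OuterStop Q j :=
    ⟨J, hQ.outerStop_of_alpha_succ_lt hp hδ hy hcpt hA hK hxm hd hJ hJ'⟩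
  -- The first stopping level is no later than the last one above α_*, so the one-level results
  -- apply to every level reached.
  have hle : Nat.find hex ≤ J := Nat.find_min' hex
    (hQ.outerStop_of_alpha_succ_lt hp hδ hy hcpt hA hK hxm hd hJ hJ')
  have hα : ∀ j ≤ Nat.find hex, P.alphaStar ≤ Q.alpha j := fun j hj =>
    hJ.trans (hQ.alpha_antitone hδ hA (hj.trans hle))
  refine ⟨Nat.find hex, fun j hj => ?_, fun j hj k hk => ?_, fun j hj => Nat.find_min hex hj,
    Nat.find_spec hex, hα _ le_rfl⟩
  · exact (hQ.level hp hδ hy hcpt hA hK hxm hd (hα j hj)).exists_innerStop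
      (hQ.breg_start_le hp hδ hy hcpt hA hK hxm hd j (hα j hj))
  · exact (hQ.level hp hδ hy hcpt hA hK hxm hd (hα j hj)).breg_inner_le_of_le_kStop
      (hQ.breg_start_le hp hδ hy hcpt hA hK hxm hd j (hα j hj)) hk
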